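/- Let $(A,\mathfrak m)$ be a Cohen--Macaulay (Noetherian) local ring of dimension $d$, and let $\operatorname{CM}(A)$ be the category of maximal Cohen--Macaulay (MCM) $A$-modules, i.e. of finitely generated $A$-modules that are zero or of depth $d$, with all $A$-linear maps. For $M\in\operatorname{CM}(A)$ put $$e^T(M)=\lim_{n\to\infty}\frac{(d-1)!}{n^{d-1}}\,\ell\big(\operatorname{Tor}_1^A(M,A/\mathfrak m^{n+1})\big)$$ (if $d=0$, the factor $(d-1)!/n^{d-1}$ is read as $1$; then $\operatorname{Tor}_1^A(M,A/\mathfrak m^{n+1})=0$ for $n\gg0$ and $e^T(M)=0$). For a short exact sequence $s\colon 0\to N\to E\to M\to 0$ with $M,N\in\operatorname{CM}(A)$ put $e^T(s)=e^T(M)+e^T(N)-e^T(E)$, and let $T_A(M,N)\subseteq\operatorname{Ext}^1_A(M,N)$ be the set of classes of such sequences $s$ with $e^T(s)=0$. Then: 1. For every $M\in\operatorname{CM}(A)$ the lengths above are finite and the limit $e^T(M)$ exists in $\mathbb R$. 2. For every short exact sequence $s\colon 0\to N\to E\to M\to0$ with $M,N\in\operatorname{CM}(A)$ the module $E$ is MCM,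 and the class of $s$ lies in $T_A(M,N)$ if and only if $e^T(s)=0$; thus the condition $e^T(s)=0$ depends only on the class of $s$. 3. For all $M,N\in\operatorname{CM}(A)$, $T_A(M,N)$ is an $A$-submodule of $\operatorname{Ext}^1_A(M,N)$. 4. $T_A$ is a subfunctor of $\operatorname{Ext}^1_A(-,-)\colon \operatorname{CM}(A)^{\mathrm{op}}\times\operatorname{CM}(A)\to\operatorname{mod}(A)$, where $\operatorname{mod}(A)$ is the category of finitely generated $A$-modules: there are a functor $T\colon \operatorname{CM}(A)^{\mathrm{op}}\times\operatorname{CM}(A)\to\operatorname{mod}(A)$ and a natural transformation $T\to\operatorname{Ext}^1_A(-,-)$ all of whose components are injective, with image $T_A(M,N)$ at $(M,N)$. -/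

import Mathlib

open CategoryTheory CategoryTheory.Abelian

universe u

noncomputable section

namespace TorSplit

/-- A maximal Cohen–Macaulay module over a local ring `A`: a finitely generated module which is
zero or admits a regular sequence of length `dim A` inside the maximal ideal, i.e. has depth
`dim A`. (The zero module, of depth `∞`, is included.) -/
def IsMCM (A : Type u) [CommRing A] [IsLocalRing A]
    (M : Type u) [AddCommGroup M] [Module A M] : Prop :=
  Module.Finite A M ∧ (Subsingleton M ∨
    ∃ rs : List A, (∀ r ∈ rs, r ∈ IsLocalRing.maximalIdeal A) ∧
      (rs.length : WithBot ℕ∞) = ringKrullDim A ∧ RingTheory.Sequence.IsRegular M rs)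

/-- A Cohen–Macaulay local ring: Noetherian, local, and of depth `dim A` over itself. -/
class IsCohenMacaulayLocal (A : Type u) [CommRing A] : Prop extends
    IsNoetherianRing A, IsLocalRing A where
  isMCM_self : IsMCM A A

/-- The property of being maximal Cohen–Macaulay, on the category of `A`-modules. -/
def mcmProperty (A : Type u) [CommRing A] [IsLocalRing A] :
    ObjectProperty (ModuleCat.{u} A) :=
  fun M => IsMCM A M

/-- The category `CM(A)` of maximal Cohen–Macaulay modules with all `A`-linear maps. -/
abbrev CM (A : Type u) [CommRing A] [IsLocalRing A] := (mcmProperty A).FullSubcategory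

/-- The `A`-module `Tor₁(M, A/𝔪ⁿ⁺¹)`. (`Tor'` is the left derived functor of the tensor product
in the first variable.) -/
abbrev torOne (A : Type u) [CommRing A] [IsLocalRing A] (M : ModuleCat.{u} A) (n : ℕ) :
    ModuleCat.{u} A :=
  ((Tor' (ModuleCat.{u} A) 1).obj M).obj
    (ModuleCat.of A (A ⧸ IsLocalRing.maximalIdeal A ^ (n + 1)))

/-- The Krull dimension as a natural number (it is finite for Noetherian local rings). -/
def dim (A : Type u) [CommRing A] : ℕ := ((ringKrullDim A).unbotD 0).toNat

/-- The sequence `(d-1)! / n^(d-1) * ℓ(Tor₁(M, A/𝔪ⁿ⁺¹))`, where `d = dim A`. For `d = 0` the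
factor is `1`; then `Tor₁(M, A/𝔪ⁿ⁺¹) = 0` for large `n`, so the limit is `0` in any
normalization. -/
def eTSeq (A : Type u) [CommRing A] [IsLocalRing A] (M : ModuleCat.{u} A) (n : ℕ) : ℝ :=
  ((dim A - 1).factorial : ℝ) / (n : ℝ) ^ (dim A - 1) *
    ((Module.length A (torOne A M n)).toNat : ℝ)

/-- `e^T(M)`, the limit of `eTSeq A M`. -/
def eT (A : Type u) [CommRing A] [IsLocalRing A] (M : ModuleCat.{u} A) : ℝ :=
  Filter.limUnder Filter.atTop (eTSeq A M)

/-- `e^T(s) = e^T(M) + e^T(N) - e^T(E)` for `s : N ⟶ E ⟶ M`. -/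
def eTDefect (A : Type u) [CommRing A] [IsLocalRing A]
    (S : ShortComplex (ModuleCat.{u} A)) : ℝ :=
  eT A S.X₃ + eT A S.X₁ - eT A S.X₂

/-- `T_A(M, N)`, the set of classes in `Ext¹(M, N)` of extensions `0 ⟶ N ⟶ E ⟶ M ⟶ 0` with
`e^T = 0`. -/
def tSplit (A : Type u) [CommRing A] [IsLocalRing A] (M N : ModuleCat.{u} A) :
    Set (Ext.{u} M N 1) :=
  {α | ∃ (E : ModuleCat.{u} A) (i : N ⟶ E) (p : E ⟶ M) (w : i ≫ p = 0)
    (hS : (ShortComplex.mk i p w).ShortExact),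
    hS.extClass = α ∧ eTDefect A (ShortComplex.mk i p w) = 0}

lemma finite_ext (A : Type u) [CommRing A] [IsLocalRing A] [IsNoetherianRing A] (M N : CM A) :
    Module.Finite A (Ext.{u} M.obj N.obj 1) := by
  have : Module.Finite A M.obj := M.property.1
  have : Module.Finite A N.obj := N.property.1
  infer_instance

/-- The bifunctor `Ext¹ : CM(A)ᵒᵖ × CM(A) ⥤ mod(A)` (curried). A map `f : N ⟶ N'` acts by
postcomposition and a map `g : M' ⟶ M` by precomposition. -/
def extOne (A : Type u) [CommRing A] [IsLocalRing A] [IsNoetherianRing A] :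
    (CM A)ᵒᵖ ⥤ CM A ⥤ FGModuleCat.{u} A where
  obj M :=
    { obj N := ⟨ModuleCat.of A (Ext.{u} M.unop.obj N.obj 1), finite_ext A M.unop N⟩
      map f := ObjectProperty.homMk
        (ModuleCat.ofHom ((Ext.mk₀ f.hom).postcompOfLinear A M.unop.obj (add_zero 1)))
      map_id N := by
        apply FGModuleCat.hom_ext
        ext α
        simp
      map_comp f g := by
        apply FGModuleCat.hom_ext
        ext α
        simp [← Ext.mk₀_comp_mk₀, Ext.comp_assoc_of_second_deg_zero] }
  map g :=
    { app N := ObjectProperty.homMk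
        (ModuleCat.ofHom ((Ext.mk₀ g.unop.hom).precompOfLinear A N.obj (zero_add 1)))
      naturality N N' f := by
        apply FGModuleCat.hom_ext
        ext α
        simp [Ext.comp_assoc_of_third_deg_zero] }
  map_id M := by
    ext N
    simp
  map_comp g h := by
    ext N
    simp

end TorSplit

end

/-!
Present `M` by a finite projective `F` with kernel `K`. Then `ℓ(Tor₁(M, A/𝔪ⁿ⁺¹))` is an alternating
sum of the Hilbert–Samuel functions of `K`, `F` and `M`, hence eventually polynomial in `n`, of
degree at most `d` by Hilbert–Serre and dimension theory. By Artin–Rees the degree is at most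
`d - 1`, so the limit `e^T(M)` exists. The horseshoe lemma and right exactness of the tensor product
make `e^T` subadditive on short exact sequences, and it is additive on direct sums.

These two properties suffice for the rest. A pull-back square with corners `X₁`, `X₂`, `X₃`, `X₄`
along an epimorphism is a short exact sequence `0 ⟶ X₁ ⟶ X₂ ⊞ X₃ ⟶ X₄ ⟶ 0`, so that
`e(X₂) + e(X₃) ≤ e(X₁) + e(X₄)`, and dually for push-outs. Applied to the squares that define the
functoriality and the addition of `Ext¹`, this shows that the extensions along which `e^T` is
additive are stable under these operations.
-/

noncomputable section

namespace TorSplit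

open Filter Limits TensorProduct
open IsLocalRing (maximalIdeal)

/-- `f` agrees, for all large arguments, with a polynomial function of degree less than `d`. In
particular `EventuallyPoly 0 f` says that `f` is eventually zero. -/
def EventuallyPoly (d : ℕ) (f : ℕ → ℝ) : Prop :=
  ∃ p ∈ Polynomial.degreeLT ℝ d, f =ᶠ[atTop] fun n => p.eval (n : ℝ)

section EventuallyPoly

open Polynomial

lemma taylor_sub_mem_degreeLT {R : Type*} [CommRing R] {d : ℕ} {p : R[X]}
    (hp : p ∈ degreeLT R (d + 1)) (c : R) : taylor c p - p ∈ degreeLT R d := by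
  rw [mem_degreeLT] at hp ⊢
  rcases eq_or_ne p 0 with rfl | hp₀
  · simp
  · have hne : taylor c p ≠ 0 := by rwa [Ne, taylor_eq_zero]
    refine (degree_sub_lt_left (degree_taylor p c) hne (leadingCoeff_taylor c p)).trans_le ?_
    rw [degree_taylor]
    exact Order.lt_succ_iff.1 hp

lemma exists_taylor_one_sub_eq {K : Type*} [Field K] [CharZero K] {d : ℕ} {p : K[X]}
    (hp : p ∈ degreeLT K d) : ∃ q ∈ degreeLT K (d + 1), taylor 1 q - q = p := by
  induction d generalizing p with
  | zero =>
    have hp₀ : p = 0 := by simpa [mem_degreeLT] using hp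
    exact ⟨0, zero_mem _, by simp [hp₀]⟩
  | succ d ih =>
    let q : K[X] := monomial (d + 1) (p.coeff d / (d + 1))
    have hq : q ∈ degreeLT K (d + 2) := mem_degreeLT.2
      ((degree_monomial_le _ _).trans_lt (by exact_mod_cast Nat.lt_succ_self (d + 1)))
    have hr : p - (taylor 1 q - q) ∈ degreeLT K d := by
      have hmem := sub_mem hp (taylor_sub_mem_degreeLT hq 1)
      rw [mem_degreeLT, degree_lt_iff_coeff_zero] at hmem ⊢
      intro m hm
      rcases hm.eq_or_lt with rfl | hm
      · have : (d : K) + 1 ≠ 0 := by exact_mod_cast d.succ_ne_zero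
        rw [coeff_sub, coeff_sub, taylor_monomial, coeff_C_mul, coeff_X_add_C_pow,
          coeff_monomial_of_ne _ (Nat.lt_succ_self d).ne]
        simp [field]
      · exact hmem m hm
    obtain ⟨s, hs, hsr⟩ := ih hr
    refine ⟨q + s, add_mem hq (degreeLT_mono (Nat.le_succ _) hs), ?_⟩
    rw [map_add, add_sub_add_comm, hsr, add_sub_cancel]

namespace EventuallyPoly

variable {d e : ℕ} {f g : ℕ → ℝ}

lemma congr (hf : EventuallyPoly d f) (h : f =ᶠ[atTop] g) : EventuallyPoly d g :=
  let ⟨p, hp, hfp⟩ := hf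
  ⟨p, hp, h.symm.trans hfp⟩

lemma add (hf : EventuallyPoly d f) (hg : EventuallyPoly d g) :
    EventuallyPoly d fun n => f n + g n := by
  obtain ⟨p, hp, hfp⟩ := hf
  obtain ⟨q, hq, hgq⟩ := hg
  refine ⟨p + q, add_mem hp hq, ?_⟩
  filter_upwards [hfp, hgq] with n hfn hgn
  rw [hfn, hgn, eval_add]

lemma sub (hf : EventuallyPoly d f) (hg : EventuallyPoly d g) :
    EventuallyPoly d fun n => f n - g n := by
  obtain ⟨p, hp, hfp⟩ := hf
  obtain ⟨q, hq, hgq⟩ := hg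
  refine ⟨p - q, sub_mem hp hq, ?_⟩
  filter_upwards [hfp, hgq] with n hfn hgn
  rw [hfn, hgn, eval_sub]

lemma comp_add (hf : EventuallyPoly d f) (c : ℕ) : EventuallyPoly d fun n => f (n + c) := by
  obtain ⟨p, hp, hfp⟩ := hf
  refine ⟨taylor (c : ℝ) p, by simpa [mem_degreeLT] using hp, ?_⟩
  filter_upwards [(tendsto_add_atTop_nat c).eventually hfp] with n hn
  rw [hn, taylor_eval, Nat.cast_add]

lemma of_comp_add {c : ℕ} (hf : EventuallyPoly d fun n => f (n + c)) : EventuallyPoly d f := by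
  obtain ⟨p, hp, hfp⟩ := hf
  refine ⟨taylor (-c : ℝ) p, by simpa [mem_degreeLT] using hp, ?_⟩
  filter_upwards [(tendsto_sub_atTop_nat c).eventually hfp, eventually_ge_atTop c] with n hn hcn
  rw [Nat.sub_add_cancel hcn] at hn
  rw [hn, taylor_eval, Nat.cast_sub hcn, sub_eq_add_neg]

lemma comp_add_sub (hf : EventuallyPoly (d + 1) f) (c : ℕ) :
    EventuallyPoly d fun n => f (n + c) - f n := by
  obtain ⟨p, hp, hfp⟩ := hf
  refine ⟨taylor (c : ℝ) p - p, taylor_sub_mem_degreeLT hp _, ?_⟩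
  filter_upwards [hfp, (tendsto_add_atTop_nat c).eventually hfp] with n hn hnc
  rw [hn, hnc, eval_sub, taylor_eval, Nat.cast_add]

lemma of_succ_sub (hf : EventuallyPoly d fun n => f (n + 1) - f n) : EventuallyPoly (d + 1) f := by
  obtain ⟨p, hp, hfp⟩ := hf
  obtain ⟨q, hq, rfl⟩ := exists_taylor_one_sub_eq hp
  obtain ⟨N, hN⟩ := eventually_atTop.1 hfp
  refine ⟨q + C (f N - q.eval (N : ℝ)), add_mem hq ?_, ?_⟩
  · exact mem_degreeLT.2 (degree_C_le.trans_lt (by exact_mod_cast d.succ_pos))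
  · filter_upwards [eventually_ge_atTop N] with n hn
    induction n, hn using Nat.le_induction with
    | base => simp
    | succ n hn ih =>
      have hstep := hN n hn
      simp only [eval_sub, taylor_eval, eval_add, eval_C, Nat.cast_succ] at hstep ih ⊢
      linarith

lemma of_le (hf : EventuallyPoly e f) (hg : EventuallyPoly d g) (h₀ : ∀ n, 0 ≤ f n)
    (hfg : ∀ n, f n ≤ g n) : EventuallyPoly d f := by
  obtain ⟨p, -, hfp⟩ := hf
  obtain ⟨q, hq, hgq⟩ := hg
  refine ⟨p, mem_degreeLT.2 (lt_of_le_of_lt ?_ (mem_degreeLT.1 hq)), hfp⟩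
  by_contra! hlt
  have hp₀ : p ≠ 0 := by
    rintro rfl
    simp at hlt
  have hcast := tendsto_natCast_atTop_atTop (R := ℝ)
  have hfg' : f =O[atTop] g := Asymptotics.isBigO_of_le _ fun n => by
    rw [Real.norm_of_nonneg (h₀ n), Real.norm_of_nonneg ((h₀ n).trans (hfg n))]
    exact hfg n
  have hgf : g =o[atTop] f :=
    ((isLittleO_atTop_of_degree_lt q p hlt).comp_tendsto hcast).congr' hgq.symm hfp.symm
  refine Asymptotics.isLittleO_irrefl ?_ (hfg'.trans_isLittleO hgf)
  refine Eventually.frequently ?_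
  filter_upwards [hfp, hcast.eventually (p.eventually_atTop_not_isRoot hp₀)] with n hn hroot
  rwa [hn]

lemma exists_tendsto (hf : EventuallyPoly d f) :
    ∃ l, Tendsto (fun n : ℕ => f n / (n : ℝ) ^ (d - 1)) atTop (nhds l) := by
  obtain ⟨p, hp, hfp⟩ := hf
  rw [mem_degreeLT] at hp
  have hle : p.degree ≤ (X ^ (d - 1) : ℝ[X]).degree := by
    rw [degree_X_pow]
    cases d with
    | zero => exact hp.le
    | succ d => exact Order.lt_succ_iff.1 hp
  suffices ∃ l, Tendsto (fun x : ℝ => p.eval x / (X ^ (d - 1) : ℝ[X]).eval x) atTop (nhds l) by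
    obtain ⟨l, hl⟩ := this
    refine ⟨l, (hl.comp tendsto_natCast_atTop_atTop).congr' ?_⟩
    filter_upwards [hfp] with n hn
    simp [hn]
  rcases hle.lt_or_eq with h | h
  · exact ⟨0, div_tendsto_atTop_zero_of_degree_lt _ _ h⟩
  · exact ⟨_, div_tendsto_atTop_leadingCoeff_div_of_degree_eq _ _ h⟩

end EventuallyPoly

end EventuallyPoly

/-- The length of a module as a real number, with junk value `0` for modules of infinite length.
Being real-valued, it can be subtracted and compared with polynomials. -/
def realLength (A : Type*) [Ring A] (M : Type*) [AddCommGroup M] [Module A M] : ℝ :=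
  ((Module.length A M).toNat : ℝ)

section RealLength

variable {A : Type*} [Ring A] {M N P : Type*} [AddCommGroup M] [Module A M]
  [AddCommGroup N] [Module A N] [AddCommGroup P] [Module A P]

lemma realLength_nonneg : 0 ≤ realLength A M := Nat.cast_nonneg _

lemma realLength_eq_zero_of_subsingleton [Subsingleton M] : realLength A M = 0 := by
  simp [realLength, Module.length_eq_zero]

lemma realLength_congr (e : M ≃ₗ[A] N) : realLength A M = realLength A N := by
  rw [realLength, e.length_eq, realLength]

lemma realLength_le_of_surjective (h : IsFiniteLength A M) {f : M →ₗ[A] N}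
    (hf : Function.Surjective f) : realLength A N ≤ realLength A M :=
  Nat.cast_le.2 (ENat.toNat_le_toNat (Module.length_le_of_surjective f hf)
    (Module.length_ne_top_iff.2 h))

lemma realLength_eq_add_of_exact (h : IsFiniteLength A M) {f : N →ₗ[A] M} {g : M →ₗ[A] P}
    (hf : Function.Injective f) (hg : Function.Surjective g) (hfg : Function.Exact f g) :
    realLength A M = realLength A N + realLength A P := by
  rw [realLength, Module.length_eq_add_of_exact f g hf hg hfg,
    ENat.toNat_add (Module.length_ne_top_iff.2 (h.of_injective hf))
      (Module.length_ne_top_iff.2 (h.of_surjective hg)), Nat.cast_add, realLength, realLength]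

lemma realLength_eq_ker_add_range (h : IsFiniteLength A M) (f : M →ₗ[A] N) :
    realLength A M = realLength A (LinearMap.ker f) + realLength A (LinearMap.range f) :=
  realLength_eq_add_of_exact h (LinearMap.ker f).subtype_injective f.surjective_rangeRestrict
    (LinearMap.exact_iff.2 (by simp))

lemma realLength_eq_add_quotient (h : IsFiniteLength A M) (L : Submodule A M) :
    realLength A M = realLength A L + realLength A (M ⧸ L) :=
  realLength_eq_add_of_exact h L.subtype_injective L.mkQ_surjective
    (LinearMap.exact_subtype_mkQ L)

lemma realLength_quotient_range_sub_ker (hM : IsFiniteLength A M) (hN : IsFiniteLength A N)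
    (f : M →ₗ[A] N) :
    realLength A (N ⧸ LinearMap.range f) - realLength A (LinearMap.ker f) =
      realLength A N - realLength A M := by
  linarith [realLength_eq_ker_add_range hM f, realLength_eq_add_quotient hN (LinearMap.range f)]

lemma mapQ_subtype_injective (L K : Submodule A M) :
    Function.Injective (Submodule.mapQ (L.comap K.subtype) L K.subtype le_rfl) := by
  rw [← LinearMap.ker_eq_bot, Submodule.ker_mapQ, Submodule.mkQ_map_self]

lemma realLength_quotient_eq_add (L K : Submodule A M) (h : IsFiniteLength A (M ⧸ L)) :
    realLength A (M ⧸ L) =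
      realLength A (K ⧸ L.comap K.subtype) + realLength A (M ⧸ (K ⊔ L)) := by
  refine realLength_eq_add_of_exact h (mapQ_subtype_injective L K)
    (Submodule.factor_surjective (le_sup_right : L ≤ K ⊔ L)) ?_
  rw [LinearMap.exact_iff, Submodule.range_mapQ, Submodule.range_subtype, Submodule.factor,
    Submodule.ker_mapQ, Submodule.comap_id, Submodule.map_sup, Submodule.mkQ_map_self, sup_bot_eq]

lemma realLength_prod (hM : IsFiniteLength A M) (hN : IsFiniteLength A N) :
    realLength A (M × N) = realLength A M + realLength A N := by
  rw [realLength, Module.length_prod, ENat.toNat_add (Module.length_ne_top_iff.2 hM)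
    (Module.length_ne_top_iff.2 hN), Nat.cast_add, realLength, realLength]

end RealLength

section HilbertSerre

variable {A : Type*} [Ring A] {ι : Type*} {k : ℕ} {G H : ℕ → Type*}
  [∀ n, AddCommGroup (G n)] [∀ n, Module A (G n)] [∀ n, AddCommGroup (H n)] [∀ n, Module A (H n)]

/-- The families of submodules `U n ≤ G n` stable under degree-one operators `x i`: the graded
submodules of `⨁ n, G n` when the operators are multiplications by generators in degree one. -/
def IsStable (x : ι → ∀ n, G n →ₗ[A] G (n + 1)) (U : ∀ n, Submodule A (G n)) : Prop :=
  ∀ i n, (U n).map (x i n) ≤ U (n + 1)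

/-- The chain condition on `⨁ n, G n` with its degree-one operators `x i` that Hilbert–Serre needs:
every stable family is, in large degrees, generated by its predecessors. It follows from all graded
submodules being finitely generated. -/
def IsGradedNoetherian (x : ι → ∀ n, G n →ₗ[A] G (n + 1)) : Prop :=
  ∀ U : ∀ n, Submodule A (G n), IsStable x U → ∀ᶠ n in atTop, U (n + 1) ≤ ⨆ i, (U n).map (x i n)

namespace IsGradedNoetherian

variable {x : Fin (k + 1) → ∀ n, G n →ₗ[A] G (n + 1)} {y : Fin k → ∀ n, H n →ₗ[A] H (n + 1)}

lemma comp_succ {x : ι → ∀ n, G n →ₗ[A] G (n + 1)} (hx : IsGradedNoetherian x) :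
    IsGradedNoetherian (G := fun n => G (n + 1)) fun i n => x i (n + 1) := by
  intro U hU
  refine (tendsto_add_atTop_nat 1).eventually (hx (fun n => match n with
    | 0 => ⊥
    | n + 1 => U n) fun i n => ?_)
  cases n with
  | zero => simp
  | succ n => exact hU i n

lemma of_injective (hx : IsGradedNoetherian x) (f : ∀ n, H n →ₗ[A] G n)
    (hf : ∀ n, Function.Injective (f n)) (hzero : ∀ n, x 0 n ∘ₗ f n = 0)
    (hcomm : ∀ i n, x (Fin.succ i) n ∘ₗ f n = f (n + 1) ∘ₗ y i n) : IsGradedNoetherian y := by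
  intro U hU
  have hmap_zero n : ((U n).map (f n)).map (x 0 n) = ⊥ := by
    rw [← Submodule.map_comp, hzero, Submodule.map_zero]
  have hmap_succ i n : ((U n).map (f n)).map (x (Fin.succ i) n) =
      ((U n).map (y i n)).map (f (n + 1)) := by
    rw [← Submodule.map_comp, hcomm, Submodule.map_comp]
  filter_upwards [hx (fun n => (U n).map (f n)) (Fin.cases (fun n => by simp [hmap_zero])
    fun i n => (hmap_succ i n).trans_le (Submodule.map_mono (hU i n)))] with n hn
  rw [← Submodule.map_le_map_iff_of_injective (hf (n + 1)), Submodule.map_iSup]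
  exact hn.trans (iSup_le (Fin.cases (by simp [hmap_zero])
    fun i => (hmap_succ i n).trans_le (le_iSup_of_le i le_rfl)))

lemma of_surjective (hx : IsGradedNoetherian x) (f : ∀ n, G n →ₗ[A] H n)
    (hf : ∀ n, Function.Surjective (f n)) (hzero : ∀ n, f (n + 1) ∘ₗ x 0 n = 0)
    (hcomm : ∀ i n, f (n + 1) ∘ₗ x (Fin.succ i) n = y i n ∘ₗ f n) : IsGradedNoetherian y := by
  intro U hU
  have hmap_zero n : (((U n).comap (f n)).map (x 0 n)).map (f (n + 1)) = ⊥ := by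
    rw [← Submodule.map_comp, hzero, Submodule.map_zero]
  have hmap_succ i n : (((U n).comap (f n)).map (x (Fin.succ i) n)).map (f (n + 1)) =
      (U n).map (y i n) := by
    rw [← Submodule.map_comp, hcomm, Submodule.map_comp,
      Submodule.map_comap_eq_of_surjective (hf n)]
  filter_upwards [hx (fun n => (U n).comap (f n)) (Fin.cases
    (fun n => Submodule.map_le_iff_le_comap.1 (by simp [hmap_zero]))
    fun i n => Submodule.map_le_iff_le_comap.1 ((hmap_succ i n).trans_le (hU i n)))] with n hn
  have hn' := Submodule.map_mono (f := f (n + 1)) hn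
  rw [Submodule.map_comap_eq_of_surjective (hf (n + 1)), Submodule.map_iSup] at hn'
  exact hn'.trans (iSup_le (Fin.cases (by simp [hmap_zero])
    fun i => (hmap_succ i n).trans_le (le_iSup_of_le i le_rfl)))

lemma eventually_subsingleton {x : Fin 0 → ∀ n, G n →ₗ[A] G (n + 1)} (hx : IsGradedNoetherian x) :
    ∀ᶠ n in atTop, Subsingleton (G n) := by
  rw [← map_add_atTop_eq_nat 1, eventually_map]
  filter_upwards [hx (fun _ => ⊤) fun i => i.elim0] with n hn
  rw [iSup_of_empty, le_bot_iff] at hn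
  exact (Submodule.subsingleton_iff A).1 (subsingleton_of_bot_eq_top hn.symm)

end IsGradedNoetherian

theorem eventuallyPoly_realLength {G : ℕ → Type*} [∀ n, AddCommGroup (G n)] [∀ n, Module A (G n)]
    {x : Fin k → ∀ n, G n →ₗ[A] G (n + 1)}
    (hcomm : ∀ i j n, x i (n + 1) ∘ₗ x j n = x j (n + 1) ∘ₗ x i n)
    (hx : IsGradedNoetherian x) (hfin : ∀ n, IsFiniteLength A (G n)) :
    EventuallyPoly k fun n => realLength A (G n) := by
  induction k generalizing G with
  | zero =>
    refine ⟨0, zero_mem _, ?_⟩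
    filter_upwards [hx.eventually_subsingleton] with n hn
    simp [realLength_eq_zero_of_subsingleton]
  | succ k ih =>
    have hker : EventuallyPoly k fun n => realLength A (LinearMap.ker (x 0 n)) := by
      refine ih (x := fun i n => (x i.succ n).restrict fun g hg => ?_)
        (fun i j n => LinearMap.ext fun g => Subtype.ext (LinearMap.congr_fun (hcomm _ _ _) g.1))
        (hx.of_injective (fun n => (LinearMap.ker (x 0 n)).subtype)
          (fun n => Subtype.val_injective) (fun n => LinearMap.comp_ker_subtype _)
          fun i n => rfl)
        fun n => (hfin n).of_injective (LinearMap.ker (x 0 n)).subtype_injective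
      rw [LinearMap.mem_ker] at hg ⊢
      rw [← LinearMap.comp_apply, hcomm, LinearMap.comp_apply, hg, map_zero]
    have hcoker : EventuallyPoly k fun n => realLength A (G (n + 1) ⧸ LinearMap.range (x 0 n)) := by
      refine ih (x := fun i n => Submodule.mapQ _ _ (x i.succ (n + 1)) ?_)
        (fun i j n => Submodule.linearMap_qext _ ?_)
        (hx.comp_succ.of_surjective (fun n => (LinearMap.range (x 0 n)).mkQ)
          (fun n => Submodule.mkQ_surjective _) (fun n => LinearMap.range_mkQ_comp _)
          fun i n => rfl)
        fun n => (hfin (n + 1)).of_surjective (Submodule.mkQ_surjective _)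
      · rintro _ ⟨g, rfl⟩
        exact ⟨x i.succ n g, LinearMap.congr_fun (hcomm _ _ _) g⟩
      · exact congrArg ((LinearMap.range (x 0 (n + 2))).mkQ ∘ₗ ·) (hcomm i.succ j.succ (n + 1))
    exact EventuallyPoly.of_succ_sub ((hcoker.sub hker).congr (.of_forall fun n =>
      realLength_quotient_range_sub_ker (hfin n) (hfin (n + 1)) (x 0 n)))

end HilbertSerre

section HilbertSamuel

variable {A : Type*} [CommRing A] {M : Type*} [AddCommGroup M] [Module A M]

/-- The degree-`n` piece `Iⁿ M / Iⁿ⁺¹ M` of the associated graded module of `M`. -/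
abbrev AdicPiece (I : Ideal A) (M : Type*) [AddCommGroup M] [Module A M] (n : ℕ) : Type _ :=
  ↥(I ^ n • ⊤ : Submodule A M) ⧸
    (I ^ (n + 1) • ⊤ : Submodule A M).comap (I ^ n • ⊤ : Submodule A M).subtype

lemma pow_succ_smul_top_le (I : Ideal A) (n : ℕ) :
    (I ^ (n + 1) • ⊤ : Submodule A M) ≤ I ^ n • ⊤ :=
  Submodule.smul_mono_left (Ideal.pow_le_pow_right n.le_succ)

lemma smul_mem_pow_succ_smul_top {I : Ideal A} {a : A} (ha : a ∈ I) {n : ℕ} {m : M}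
    (hm : m ∈ (I ^ n • ⊤ : Submodule A M)) : a • m ∈ (I ^ (n + 1) • ⊤ : Submodule A M) := by
  rw [pow_succ', mul_smul]
  exact Submodule.smul_mem_smul ha hm

/-- Multiplication by the initial form of `a ∈ I` on the associated graded module. -/
def adicMul {I : Ideal A} {a : A} (ha : a ∈ I) (n : ℕ) :
    AdicPiece I M n →ₗ[A] AdicPiece I M (n + 1) :=
  Submodule.mapQ _ _
    ((LinearMap.lsmul A M a).restrict fun _ hm => smul_mem_pow_succ_smul_top ha hm)
    fun _ hm => smul_mem_pow_succ_smul_top ha hm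

lemma adicMul_comm {I : Ideal A} {a b : A} (ha : a ∈ I) (hb : b ∈ I) (n : ℕ) :
    adicMul (M := M) ha (n + 1) ∘ₗ adicMul hb n = adicMul hb (n + 1) ∘ₗ adicMul ha n := by
  refine Submodule.linearMap_qext _ (LinearMap.ext fun m => ?_)
  exact congrArg Submodule.Quotient.mk (Subtype.ext (smul_comm a b m.1))

/-- The preimage in `Iⁿ M ≤ M` of a submodule of `Iⁿ M / Iⁿ⁺¹ M`. -/
def adicLift {I : Ideal A} {n : ℕ} (U : Submodule A (AdicPiece I M n)) : Submodule A M :=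
  (U.comap (Submodule.mkQ _)).map (I ^ n • ⊤ : Submodule A M).subtype

lemma mem_adicLift {I : Ideal A} {n : ℕ} {U : Submodule A (AdicPiece I M n)} {m : M} :
    m ∈ adicLift U ↔ ∃ h : m ∈ (I ^ n • ⊤ : Submodule A M),
      (Submodule.Quotient.mk ⟨m, h⟩ : AdicPiece I M n) ∈ U := by
  simp [adicLift]

lemma pow_succ_smul_top_le_adicLift {I : Ideal A} {n : ℕ} (U : Submodule A (AdicPiece I M n)) :
    I ^ (n + 1) • ⊤ ≤ adicLift U := by
  intro m hm
  have hm₀ : (Submodule.Quotient.mk ⟨m, pow_succ_smul_top_le I n hm⟩ : AdicPiece I M n) = 0 :=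
    (Submodule.Quotient.mk_eq_zero _).2 hm
  exact mem_adicLift.2 ⟨_, hm₀ ▸ zero_mem U⟩

lemma adicLift_le {I : Ideal A} {n : ℕ} (U : Submodule A (AdicPiece I M n)) :
    adicLift U ≤ I ^ n • ⊤ := fun _ hm => (mem_adicLift.1 hm).1

lemma span_smul_adicLift_le {ι : Type*} {x : ι → A} {I : Ideal A}
    (hI : I ≤ Ideal.span (Set.range x)) (hx : ∀ i, x i ∈ I) {n : ℕ}
    {U : Submodule A (AdicPiece I M n)} {W : Submodule A (AdicPiece I M (n + 1))}
    (h : ∀ i, U.map (adicMul (hx i) n) ≤ W) :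
    I • adicLift U ≤ adicLift W := by
  refine (Submodule.smul_mono_left hI).trans ?_
  rw [Submodule.span_smul_eq]
  refine Submodule.set_smul_le _ _ _ ?_
  rintro _ m ⟨i, rfl⟩ hm
  obtain ⟨hm', hmU⟩ := mem_adicLift.1 hm
  exact mem_adicLift.2 ⟨smul_mem_pow_succ_smul_top (hx i) hm', h i ⟨_, hmU, rfl⟩⟩

theorem isGradedNoetherian_adicMul [IsNoetherianRing A] [Module.Finite A M] {ι : Type*} {x : ι → A}
    {I : Ideal A} (hI : I ≤ Ideal.span (Set.range x)) (hx : ∀ i, x i ∈ I) :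
    IsGradedNoetherian fun i n => adicMul (M := M) (hx i) n := by
  intro U hU
  let F : I.Filtration M :=
    { N n := adicLift (U n)
      mono n := (adicLift_le (U (n + 1))).trans (pow_succ_smul_top_le_adicLift (U n))
      smul_le n := span_smul_adicLift_le hI hx fun i => hU i n }
  obtain ⟨n₀, hn₀⟩ := (I.stableFiltration_stable ⊤).of_le (F' := F) fun n => adicLift_le (U n)
  filter_upwards [eventually_ge_atTop n₀] with n hn u hu
  obtain ⟨u, rfl⟩ := Submodule.mkQ_surjective _ u
  have hmem : u.1 ∈ I • adicLift (U n) := (hn₀ n hn).ge (mem_adicLift.2 ⟨u.2, hu⟩)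
  exact (mem_adicLift.1 (span_smul_adicLift_le hI hx
    (fun i => le_iSup (fun i => (U n).map (adicMul (hx i) n)) i) hmem)).2

theorem eventuallyPoly_realLength_quotient_pow_smul [IsNoetherianRing A] [Module.Finite A M] {k : ℕ}
    {x : Fin k → A} {I : Ideal A} (hI : I = Ideal.span (Set.range x))
    (hfin : ∀ n, IsFiniteLength A (M ⧸ (I ^ n • ⊤ : Submodule A M))) :
    EventuallyPoly (k + 1) fun n => realLength A (M ⧸ (I ^ n • ⊤ : Submodule A M)) := by
  have hx i : x i ∈ I := hI ▸ Ideal.subset_span ⟨i, rfl⟩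
  have hpiece n : IsFiniteLength A (AdicPiece I M n) :=
    (hfin (n + 1)).of_injective (mapQ_subtype_injective _ _)
  refine .of_succ_sub ((eventuallyPoly_realLength (fun i j n => adicMul_comm (hx i) (hx j) n)
    (isGradedNoetherian_adicMul hI.le hx) hpiece).congr (.of_forall fun n => ?_))
  have hadd := realLength_quotient_eq_add _ (I ^ n • ⊤ : Submodule A M) (hfin (n + 1))
  rw [sup_of_le_left (pow_succ_smul_top_le I n)] at hadd
  exact (sub_eq_of_eq_add hadd).symm

end HilbertSamuel

section TorLength

variable {A : Type*} [CommRing A]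

lemma exists_presentation_comparison {F F' M : Type*} [AddCommGroup F] [Module A F]
    [AddCommGroup F'] [Module A F'] [AddCommGroup M] [Module A M] [Module.Projective A F]
    [Module.Projective A F'] {π : F →ₗ[A] M} {π' : F' →ₗ[A] M} (hπ : Function.Surjective π)
    (hπ' : Function.Surjective π') :
    ∃ (φ : F →ₗ[A] F') (φK : LinearMap.ker π →ₗ[A] LinearMap.ker π')
      (ψK : LinearMap.ker π' →ₗ[A] LinearMap.ker π) (s : F →ₗ[A] LinearMap.ker π),
      (LinearMap.ker π').subtype ∘ₗ φK = φ ∘ₗ (LinearMap.ker π).subtype ∧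
        ψK ∘ₗ φK + s ∘ₗ (LinearMap.ker π).subtype = LinearMap.id := by
  obtain ⟨φ, hφ⟩ := Module.projective_lifting_property π' π hπ'
  obtain ⟨ψ, hψ⟩ := Module.projective_lifting_property π π' hπ
  have hφ' x : π' (φ x) = π x := LinearMap.congr_fun hφ x
  have hψ' x : π (ψ x) = π' x := LinearMap.congr_fun hψ x
  refine ⟨φ, φ.restrict (by simp [hφ']), ψ.restrict (by simp [hψ']),
    (LinearMap.id - ψ ∘ₗ φ).codRestrict (LinearMap.ker π) (by simp [hψ', hφ']), rfl, ?_⟩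
  exact LinearMap.ext fun x => Subtype.ext (add_sub_cancel (ψ (φ x)) x.1)

lemma length_ker_rTensor_subtype_le {F F' M : Type*} [AddCommGroup F] [Module A F]
    [AddCommGroup F'] [Module A F'] [AddCommGroup M] [Module A M] [Module.Projective A F]
    [Module.Projective A F'] {π : F →ₗ[A] M} {π' : F' →ₗ[A] M} (hπ : Function.Surjective π)
    (hπ' : Function.Surjective π') (B : Type*) [AddCommGroup B] [Module A B] :
    Module.length A (LinearMap.ker ((LinearMap.ker π).subtype.rTensor B)) ≤
      Module.length A (LinearMap.ker ((LinearMap.ker π').subtype.rTensor B)) := by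
  obtain ⟨φ, φK, ψK, s, hφK, hs⟩ := exists_presentation_comparison hπ hπ'
  have hmem x (hx : x ∈ LinearMap.ker ((LinearMap.ker π).subtype.rTensor B)) :
      φK.rTensor B x ∈ LinearMap.ker ((LinearMap.ker π').subtype.rTensor B) := by
    rw [LinearMap.mem_ker, ← LinearMap.rTensor_comp_apply, hφK, LinearMap.rTensor_comp_apply,
      LinearMap.mem_ker.1 hx, map_zero]
  refine Module.length_le_of_injective ((φK.rTensor B).restrict hmem)
    ((injective_iff_map_eq_zero _).2 fun x hx => Subtype.ext ?_)
  have hx' : φK.rTensor B x.1 = 0 := congrArg Subtype.val hx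
  simpa [LinearMap.rTensor_add, LinearMap.rTensor_comp_apply, hx', LinearMap.mem_ker.1 x.2]
    using (LinearMap.congr_fun (congrArg (LinearMap.rTensor B) hs) x.1).symm

lemma length_ker_quotient_range {X₀ X₁ X₂ W : Type*} [AddCommGroup X₀] [Module A X₀]
    [AddCommGroup X₁] [Module A X₁] [AddCommGroup X₂] [Module A X₂] [AddCommGroup W] [Module A W]
    {d₂ : X₂ →ₗ[A] X₁} {d₁ : X₁ →ₗ[A] X₀} {r : X₁ →ₗ[A] W} {i : W →ₗ[A] X₀} (hd₁ : i ∘ₗ r = d₁)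
    (hr : Function.Surjective r) (hdr : Function.Exact d₂ r)
    (h : ∀ x, d₂ x ∈ LinearMap.ker d₁) :
    Module.length A (LinearMap.ker d₁ ⧸ LinearMap.range (d₂.codRestrict (LinearMap.ker d₁) h)) =
      Module.length A (LinearMap.ker i) := by
  subst hd₁
  let θ : LinearMap.ker (i ∘ₗ r) →ₗ[A] LinearMap.ker i := r.restrict fun x hx => hx
  have hθ : Function.Surjective θ := by
    rintro ⟨y, hy⟩
    obtain ⟨x, rfl⟩ := hr y
    exact ⟨⟨x, hy⟩, rfl⟩
  have hker : LinearMap.range (d₂.codRestrict (LinearMap.ker (i ∘ₗ r)) h) = LinearMap.ker θ := by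
    ext x
    rw [LinearMap.range_codRestrict, Submodule.mem_comap, ← hdr.linearMap_ker_eq]
    exact (Subtype.ext_iff (a1 := θ x) (a2 := 0)).symm
  exact (Submodule.quotEquivOfEq _ _ hker ≪≫ₗ θ.quotKerEquivOfSurjective hθ).length_eq

lemma length_homology_rTensor {P₀ P₁ P₂ : Type*} [AddCommGroup P₀] [Module A P₀] [AddCommGroup P₁]
    [Module A P₁] [AddCommGroup P₂] [Module A P₂] {d₂ : P₂ →ₗ[A] P₁} {d₁ : P₁ →ₗ[A] P₀}
    (hd : Function.Exact d₂ d₁) (B : Type*) [AddCommGroup B] [Module A B]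
    (h : ∀ x, d₂.rTensor B x ∈ LinearMap.ker (d₁.rTensor B)) :
    Module.length A (LinearMap.ker (d₁.rTensor B) ⧸
        LinearMap.range ((d₂.rTensor B).codRestrict (LinearMap.ker (d₁.rTensor B)) h)) =
      Module.length A (LinearMap.ker ((LinearMap.range d₁).subtype.rTensor B)) :=
  have hexact : Function.Exact d₂ d₁.rangeRestrict :=
    LinearMap.exact_iff.2 (by rw [LinearMap.ker_rangeRestrict, hd.linearMap_ker_eq])
  length_ker_quotient_range (r := d₁.rangeRestrict.rTensor B)
    (by rw [← LinearMap.rTensor_comp]; rfl)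
    (LinearMap.rTensor_surjective B d₁.surjective_rangeRestrict)
    (rTensor_exact B hexact d₁.surjective_rangeRestrict) h

end TorLength

section Tor

variable {A : Type u} [CommRing A]

lemma exists_presentation_length_tor (M : ModuleCat.{u} A) :
    ∃ (F : ModuleCat.{u} A) (_ : Module.Projective A F) (π : F →ₗ[A] M), Function.Surjective π ∧
      ∀ B : ModuleCat.{u} A, Module.length A (((Tor' (ModuleCat.{u} A) 1).obj M).obj B) =
        Module.length A (LinearMap.ker ((LinearMap.ker π).subtype.rTensor B)) := by
  let P := projectiveResolution M
  have hd : Function.Exact (P.complex.d 2 1).hom (P.complex.d 1 0).hom :=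
    (ShortComplex.ShortExact.moduleCat_exact_iff_function_exact _).1 (P.exact_succ 0)
  let π : P.complex.X 0 →ₗ[A] M := (P.π.f 0).hom
  have hπ : Function.Exact (P.complex.d 1 0).hom π :=
    (ShortComplex.ShortExact.moduleCat_exact_iff_function_exact _).1 P.exact₀
  refine ⟨P.complex.X 0, (IsProjective.iff_projective _).2 (P.projective 0), π,
    (ModuleCat.epi_iff_surjective _).1 inferInstance, fun B => ?_⟩
  let T := (MonoidalCategory.tensoringRight (ModuleCat.{u} A)).obj B
  let C := (T.mapHomologicalComplex _).obj P.complex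
  have e : ((Tor' (ModuleCat.{u} A) 1).obj M).obj B ≅ (C.sc' 2 1 0).moduleCatLeftHomologyData.H :=
    P.isoLeftDerivedObj T 1 ≪≫
      ShortComplex.homologyMapIso (C.isoSc' 2 1 0 (by simp) (by simp)) ≪≫
      (C.sc' 2 1 0).moduleCatHomologyIso
  rw [e.toLinearEquiv.length_eq, hπ.linearMap_ker_eq]
  exact length_homology_rTensor hd B _

theorem length_tor_eq_length_ker_rTensor {F : Type*} [AddCommGroup F] [Module A F]
    [Module.Projective A F] {M : ModuleCat.{u} A} {π : F →ₗ[A] M} (hπ : Function.Surjective π)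
    (B : ModuleCat.{u} A) :
    Module.length A (((Tor' (ModuleCat.{u} A) 1).obj M).obj B) =
      Module.length A (LinearMap.ker ((LinearMap.ker π).subtype.rTensor B)) := by
  obtain ⟨F', _, π', hπ', hB⟩ := exists_presentation_length_tor M
  rw [hB]
  exact (length_ker_rTensor_subtype_le hπ' hπ B).antisymm (length_ker_rTensor_subtype_le hπ hπ' B)

end Tor

lemma exists_comap_pow_smul_le {A M : Type*} [CommRing A] [IsNoetherianRing A] [AddCommGroup M]
    [Module A M] [Module.Finite A M] (I : Ideal A) (K : Submodule A M) :
    ∃ c, ∀ n, (I ^ (n + c) • ⊤ : Submodule A M).comap K.subtype ≤ I ^ n • ⊤ := by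
  obtain ⟨c, hc⟩ := I.exists_pow_inf_eq_pow_smul K
  refine ⟨c, fun n => ?_⟩
  rw [← Submodule.map_le_map_iff_of_injective K.subtype_injective, Submodule.map_comap_subtype,
    Submodule.map_smul'', Submodule.map_subtype_top, inf_comm, hc _ (Nat.le_add_left c n),
    Nat.add_sub_cancel]
  exact smul_mono_right (I ^ n) inf_le_right

section HilbertFunction

variable {A : Type*} [CommRing A] [IsLocalRing A]

/-- The Hilbert–Samuel function `n ↦ ℓ(M / 𝔪ⁿ M)` of a finitely generated module `M` over a
Noetherian local ring, with real values. -/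
def hilbertSamuel (A : Type*) [CommRing A] [IsLocalRing A] (M : Type*) [AddCommGroup M]
    [Module A M] (n : ℕ) : ℝ :=
  realLength A (M ⧸ (maximalIdeal A ^ n • ⊤ : Submodule A M))

variable {M N E : Type*} [AddCommGroup M] [Module A M] [AddCommGroup N] [Module A N]
  [AddCommGroup E] [Module A E]

lemma hilbertSamuel_eq_realLength_tensor (n : ℕ) :
    hilbertSamuel A M n = realLength A (M ⊗[A] (A ⧸ maximalIdeal A ^ n)) :=
  realLength_congr (tensorQuotEquivQuotSMul M (maximalIdeal A ^ n)).symm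

lemma hilbertSamuel_congr (e : M ≃ₗ[A] N) (n : ℕ) : hilbertSamuel A M n = hilbertSamuel A N n := by
  rw [hilbertSamuel_eq_realLength_tensor, hilbertSamuel_eq_realLength_tensor,
    realLength_congr (e.rTensor _)]

lemma maximalIdeal_mem_minimalPrimes_self :
    maximalIdeal A ∈ (maximalIdeal A).minimalPrimes := by
  simp [Ideal.minimalPrimes_eq_subsingleton_self]

variable [IsNoetherianRing A]

lemma isArtinianRing_quotient_pow {I : Ideal A} (hI : maximalIdeal A ∈ I.minimalPrimes) (n : ℕ) :
    IsArtinianRing (A ⧸ I ^ n) := by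
  rcases eq_or_ne n 0 with rfl | hn
  · have : Subsingleton (A ⧸ I ^ 0) :=
      Ideal.Quotient.subsingleton_iff.2 ((pow_zero I).trans Ideal.one_eq_top)
    infer_instance
  · refine IsLocalRing.quotient_artinian_of_mem_minimalPrimes_of_isLocalRing _ ?_
    rwa [← Ideal.radical_minimalPrimes, Ideal.radical_pow _ hn, Ideal.radical_minimalPrimes]

lemma isFiniteLength_quotient_pow_smul [Module.Finite A M] {I : Ideal A}
    (hI : maximalIdeal A ∈ I.minimalPrimes) (n : ℕ) :
    IsFiniteLength A (M ⧸ (I ^ n • ⊤ : Submodule A M)) := by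
  have := isArtinianRing_quotient_pow hI n
  have : Module.Finite (A ⧸ I ^ n) (M ⧸ (I ^ n • ⊤ : Submodule A M)) :=
    Module.Finite.of_restrictScalars_finite A _ _
  rw [← Module.length_ne_top_iff,
    Module.length_eq_of_surjective (R := A ⧸ I ^ n) Ideal.Quotient.mk_surjective]
  exact Module.length_ne_top

lemma isFiniteLength_tensor_quotient_pow [Module.Finite A M] (n : ℕ) :
    IsFiniteLength A (M ⊗[A] (A ⧸ maximalIdeal A ^ n)) := by
  rw [← Module.length_ne_top_iff, (tensorQuotEquivQuotSMul M (maximalIdeal A ^ n)).length_eq,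
    Module.length_ne_top_iff]
  exact isFiniteLength_quotient_pow_smul maximalIdeal_mem_minimalPrimes_self n

lemma coe_dim : (dim A : WithBot ℕ∞) = ringKrullDim A := by
  obtain ⟨s, -, hs⟩ := (maximalIdeal A).exists_finset_card_eq_height_of_isNoetherianRing
  rw [dim, ← IsLocalRing.maximalIdeal_height_eq_ringKrullDim, ← hs]
  rfl

lemma exists_card_eq_dim_maximalIdeal_mem_minimalPrimes :
    ∃ s : Finset A, s.card = dim A ∧ maximalIdeal A ∈ (Ideal.span (s : Set A)).minimalPrimes := by
  obtain ⟨s, hs, hcard⟩ := (maximalIdeal A).exists_finset_card_eq_height_of_isNoetherianRing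
  refine ⟨s, ?_, hs⟩
  have hdim := IsLocalRing.maximalIdeal_height_eq_ringKrullDim (R := A)
  rw [← hcard, ← coe_dim] at hdim
  exact_mod_cast hdim

lemma eventuallyPoly_realLength_quotient_span_pow_smul [Module.Finite A M] {s : Finset A}
    (hs : maximalIdeal A ∈ (Ideal.span (s : Set A)).minimalPrimes) :
    EventuallyPoly (s.card + 1) fun n =>
      realLength A (M ⧸ (Ideal.span (s : Set A) ^ n • ⊤ : Submodule A M)) :=
  have hrange : Set.range (fun i => (s.equivFin.symm i : A)) = s :=
    (s.equivFin.symm.surjective.range_comp Subtype.val).trans Subtype.range_coe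
  eventuallyPoly_realLength_quotient_pow_smul (by rw [hrange])
    (isFiniteLength_quotient_pow_smul hs)

theorem eventuallyPoly_hilbertSamuel [Module.Finite A M] :
    EventuallyPoly (dim A + 1) (hilbertSamuel A M) := by
  obtain ⟨t, ht⟩ := IsNoetherian.noetherian (maximalIdeal A)
  have hpoly : EventuallyPoly (t.card + 1) (hilbertSamuel A M) := by
    have hmin : maximalIdeal A ∈ (Ideal.span (t : Set A)).minimalPrimes := by
      rw [Ideal.span, ht]
      exact maximalIdeal_mem_minimalPrimes_self
    have hspan := eventuallyPoly_realLength_quotient_span_pow_smul (M := M) hmin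
    rwa [Ideal.span, ht] at hspan
  obtain ⟨s, hcard, hs⟩ := exists_card_eq_dim_maximalIdeal_mem_minimalPrimes (A := A)
  refine hpoly.of_le (hcard ▸ eventuallyPoly_realLength_quotient_span_pow_smul (M := M) hs)
    (fun _ => realLength_nonneg) fun n => ?_
  exact realLength_le_of_surjective (isFiniteLength_quotient_pow_smul hs n)
    (Submodule.factor_surjective (Submodule.smul_mono_left (Ideal.pow_right_mono hs.1.2 n)))

lemma hilbertSamuel_le_add [Module.Finite A N] [Module.Finite A E] {i : N →ₗ[A] E} {p : E →ₗ[A] M}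
    (hp : Function.Surjective p) (h : Function.Exact i p) (n : ℕ) :
    hilbertSamuel A E n ≤ hilbertSamuel A N n + hilbertSamuel A M n := by
  have hexact := rTensor_exact (A ⧸ maximalIdeal A ^ n) h hp
  have hrange := realLength_le_of_surjective (isFiniteLength_tensor_quotient_pow n)
    (i.rTensor (A ⧸ maximalIdeal A ^ n)).surjective_rangeRestrict
  have hadd := realLength_eq_add_of_exact (isFiniteLength_tensor_quotient_pow n)
    (LinearMap.range (i.rTensor (A ⧸ maximalIdeal A ^ n))).subtype_injective
    (LinearMap.rTensor_surjective _ hp)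
    (LinearMap.exact_iff.2 (by rw [Submodule.range_subtype, hexact.linearMap_ker_eq]))
  simp only [hilbertSamuel_eq_realLength_tensor]
  linarith

lemma hilbertSamuel_prod [Module.Finite A N] [Module.Finite A E] (n : ℕ) :
    hilbertSamuel A (N × E) n = hilbertSamuel A N n + hilbertSamuel A E n := by
  simp only [hilbertSamuel_eq_realLength_tensor]
  rw [realLength_congr (TensorProduct.prodLeft A A N E _),
    realLength_prod (isFiniteLength_tensor_quotient_pow n) (isFiniteLength_tensor_quotient_pow n)]

lemma hilbertSamuel_eq_add_ker [Module.Finite A E] {π : E →ₗ[A] M} (hπ : Function.Surjective π)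
    (n : ℕ) :
    hilbertSamuel A E n =
      realLength A (LinearMap.ker π ⧸
        (maximalIdeal A ^ n • ⊤ : Submodule A E).comap (LinearMap.ker π).subtype) +
      hilbertSamuel A M n := by
  set L : Submodule A E := maximalIdeal A ^ n • ⊤
  have hmap : maximalIdeal A ^ n • (⊤ : Submodule A M) = L.map π := by
    rw [Submodule.map_smul'', Submodule.map_top, LinearMap.range_eq_top.2 hπ]
  have hker : LinearMap.ker ((L.map π).mkQ ∘ₗ π) = LinearMap.ker π ⊔ L := by
    rw [LinearMap.ker_comp, Submodule.ker_mkQ, Submodule.comap_map_eq, sup_comm]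
  have e : (E ⧸ LinearMap.ker π ⊔ L) ≃ₗ[A] M ⧸ L.map π :=
    Submodule.quotEquivOfEq _ _ hker.symm ≪≫ₗ
      LinearMap.quotKerEquivOfSurjective _ ((Submodule.mkQ_surjective _).comp hπ)
  rw [hilbertSamuel, hilbertSamuel, hmap, ← realLength_congr e]
  exact realLength_quotient_eq_add L (LinearMap.ker π)
    (isFiniteLength_quotient_pow_smul maximalIdeal_mem_minimalPrimes_self n)

lemma exists_hilbertSamuel_ker_le [Module.Finite A E] {π : E →ₗ[A] M}
    (hπ : Function.Surjective π) :
    ∃ c, ∀ n, hilbertSamuel A (LinearMap.ker π) n ≤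
      hilbertSamuel A E (n + c) - hilbertSamuel A M (n + c) := by
  obtain ⟨c, hc⟩ := exists_comap_pow_smul_le (maximalIdeal A) (LinearMap.ker π)
  refine ⟨c, fun n => ?_⟩
  have hfin : IsFiniteLength A (E ⧸ (maximalIdeal A ^ (n + c) • ⊤ : Submodule A E)) :=
    isFiniteLength_quotient_pow_smul maximalIdeal_mem_minimalPrimes_self _
  have hle := realLength_le_of_surjective
    (hfin.of_injective (mapQ_subtype_injective _ (LinearMap.ker π)))
    (Submodule.factor_surjective (hc n))
  rw [hilbertSamuel_eq_add_ker hπ, add_sub_cancel_right]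
  exact hle

end HilbertFunction

section Horseshoe

variable {A : Type*} [Ring A] {F G M N E : Type*} [AddCommGroup F] [Module A F] [AddCommGroup G]
  [Module A G] [AddCommGroup M] [Module A M] [AddCommGroup N] [Module A N] [AddCommGroup E]
  [Module A E]

lemma exists_horseshoe [Module.Projective A G] {i : N →ₗ[A] E} {p : E →ₗ[A] M}
    (hi : Function.Injective i) (hp : Function.Surjective p) (h : Function.Exact i p)
    {π : F →ₗ[A] N} {ρ : G →ₗ[A] M} (hπ : Function.Surjective π) (hρ : Function.Surjective ρ) :
    ∃ (τ : F × G →ₗ[A] E) (f : LinearMap.ker π →ₗ[A] LinearMap.ker τ)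
      (g : LinearMap.ker τ →ₗ[A] LinearMap.ker ρ),
      Function.Surjective τ ∧ Function.Surjective g ∧ Function.Exact f g := by
  obtain ⟨σ, hσ⟩ := Module.projective_lifting_property p ρ hp
  have hpσ b : p (σ b) = ρ b := LinearMap.congr_fun hσ b
  have hlift (x : E) (b : G) (hb : ρ b = p x) : ∃ a, i (π a) = x - σ b := by
    obtain ⟨y, hy⟩ := (h (x - σ b)).1 (by rw [map_sub, hpσ, hb, sub_self])
    exact (hπ y).imp fun a ha => by rw [ha, hy]
  let τ : F × G →ₗ[A] E := (i ∘ₗ π).coprod σ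
  have hpτ x : p (τ x) = ρ x.2 := by simp [τ, hpσ, h.apply_apply_eq_zero]
  refine ⟨τ, (LinearMap.inl A F G).restrict (by simp +contextual [τ]),
    (LinearMap.snd A F G).restrict fun x hx => ?_, fun x => ?_, ?_, ?_⟩
  · rw [LinearMap.mem_ker, LinearMap.snd_apply, ← hpτ, LinearMap.mem_ker.1 hx, map_zero]
  · obtain ⟨b, hb⟩ := hρ (p x)
    obtain ⟨a, ha⟩ := hlift x b hb
    exact ⟨(a, b), by simp [τ, ha]⟩
  · rintro ⟨b, hb⟩
    obtain ⟨a, ha⟩ := hlift 0 b (by rw [LinearMap.mem_ker.1 hb, map_zero])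
    exact ⟨⟨(a, b), by simp [τ, ha]⟩, rfl⟩
  · rintro ⟨⟨a, b⟩, hab⟩
    refine ⟨fun hb => ?_, ?_⟩
    · obtain rfl : b = 0 := congrArg Subtype.val hb
      exact ⟨⟨a, hi (by simpa [τ] using hab)⟩, rfl⟩
    · rintro ⟨a', ha'⟩
      exact Subtype.ext (congrArg (fun x => x.1.2) ha').symm

/-- The kernel of a product map is the product of the kernels. It compares the presentation of a
product of modules with presentations of the factors. -/
def kerProdMapEquiv (f : F →ₗ[A] M) (g : G →ₗ[A] N) :
    LinearMap.ker (f.prodMap g) ≃ₗ[A] LinearMap.ker f × LinearMap.ker g where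
  toFun x := (⟨x.1.1, congrArg Prod.fst x.2⟩, ⟨x.1.2, congrArg Prod.snd x.2⟩)
  map_add' _ _ := rfl
  map_smul' _ _ := rfl
  invFun y := ⟨(y.1.1, y.2.1), Prod.ext y.1.2 y.2.2⟩

end Horseshoe

lemma exists_finite_projective_presentation {A : Type u} [Ring A] (M : ModuleCat.{u} A)
    [Module.Finite A M] :
    ∃ (F : ModuleCat.{u} A) (_ : Module.Finite A F) (_ : Module.Projective A F)
      (π : F →ₗ[A] M), Function.Surjective π := by
  obtain ⟨r, π, hπ⟩ := Module.Finite.exists_fin' A M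
  exact ⟨.of A (Fin r → A), inferInstance, inferInstance, π, hπ⟩

section TorOne

variable {A : Type u} [CommRing A] [IsLocalRing A]

lemma eTSeq_eq_mul_realLength (M : ModuleCat.{u} A) (n : ℕ) :
    eTSeq A M n =
      ((dim A - 1).factorial : ℝ) / (n : ℝ) ^ (dim A - 1) * realLength A (torOne A M n) :=
  rfl

lemma length_torOne {M : ModuleCat.{u} A} {F : Type*} [AddCommGroup F] [Module A F]
    [Module.Projective A F] {π : F →ₗ[A] M} (hπ : Function.Surjective π) (n : ℕ) :
    Module.length A (torOne A M n) = Module.length A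
      (LinearMap.ker ((LinearMap.ker π).subtype.rTensor (A ⧸ maximalIdeal A ^ (n + 1)))) :=
  length_tor_eq_length_ker_rTensor hπ (ModuleCat.of A (A ⧸ maximalIdeal A ^ (n + 1)))

variable [IsNoetherianRing A]

lemma isFiniteLength_torOne (M : ModuleCat.{u} A) [Module.Finite A M] (n : ℕ) :
    IsFiniteLength A (torOne A M n) := by
  obtain ⟨F, _, _, π, hπ⟩ := exists_finite_projective_presentation M
  rw [← Module.length_ne_top_iff, length_torOne hπ, Module.length_ne_top_iff]
  exact (isFiniteLength_tensor_quotient_pow (n + 1)).of_injective (Submodule.subtype_injective _)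

lemma realLength_torOne {M : ModuleCat.{u} A} {F : Type*} [AddCommGroup F] [Module A F]
    [Module.Finite A F] [Module.Projective A F] {π : F →ₗ[A] M} (hπ : Function.Surjective π)
    (n : ℕ) :
    realLength A (torOne A M n) = hilbertSamuel A (LinearMap.ker π) (n + 1) -
      hilbertSamuel A F (n + 1) + hilbertSamuel A M (n + 1) := by
  let B := A ⧸ maximalIdeal A ^ (n + 1)
  have htor : realLength A (torOne A M n) =
      realLength A (LinearMap.ker ((LinearMap.ker π).subtype.rTensor B)) :=
    congrArg (fun l => (l.toNat : ℝ)) (length_torOne hπ n)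
  have hcoker : realLength A (M ⊗[A] B) =
      realLength A ((F ⊗[A] B) ⧸ LinearMap.range ((LinearMap.ker π).subtype.rTensor B)) :=
    (realLength_congr (rTensor.equiv B π.exact_subtype_ker_map hπ)).symm
  have heuler := realLength_quotient_range_sub_ker
    (isFiniteLength_tensor_quotient_pow (M := LinearMap.ker π) (n + 1))
    (isFiniteLength_tensor_quotient_pow (M := F) (n + 1)) ((LinearMap.ker π).subtype.rTensor B)
  simp only [hilbertSamuel_eq_realLength_tensor, htor]
  linarith

theorem eventuallyPoly_realLength_torOne (M : ModuleCat.{u} A) [Module.Finite A M] :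
    EventuallyPoly (dim A) fun n => realLength A (torOne A M n) := by
  obtain ⟨F, _, _, π, hπ⟩ := exists_finite_projective_presentation M
  obtain ⟨c, hc⟩ := exists_hilbertSamuel_ker_le hπ
  have hK : EventuallyPoly (dim A + 1) (hilbertSamuel A (LinearMap.ker π)) :=
    eventuallyPoly_hilbertSamuel
  have hpoly : EventuallyPoly (dim A + 1) fun n => realLength A (torOne A M n) := by
    simp only [realLength_torOne hπ]
    exact ((hK.comp_add 1).sub (eventuallyPoly_hilbertSamuel.comp_add 1)).add
      (eventuallyPoly_hilbertSamuel.comp_add 1)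
  -- By Artin–Rees, `ℓ(Tor₁(M, A/𝔪ⁿ⁺ᶜ⁺¹))` is at most `h(n + c + 1) - h(n + 1)`, where `h` is the
  -- Hilbert–Samuel function of the first syzygy; this difference has one degree less than `h`.
  refine .of_comp_add (c := c) (.of_le (hpoly.comp_add c) ((hK.comp_add_sub c).comp_add 1)
    (fun _ => realLength_nonneg) fun n => ?_)
  have hle := hc (n + 1)
  rw [realLength_torOne hπ, add_right_comm n c 1]
  linarith

theorem tendsto_eTSeq (M : ModuleCat.{u} A) [Module.Finite A M] :
    Tendsto (eTSeq A M) atTop (nhds (eT A M)) := by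
  obtain ⟨l, hl⟩ := (eventuallyPoly_realLength_torOne M).exists_tendsto
  refine tendsto_nhds_limUnder ⟨(dim A - 1).factorial * l, ?_⟩
  refine (hl.const_mul _).congr fun n => ?_
  rw [eTSeq, realLength]
  ring

lemma realLength_torOne_le_add {S : ShortComplex (ModuleCat.{u} A)} (hS : S.ShortExact)
    [Module.Finite A S.X₁] [Module.Finite A S.X₂] [Module.Finite A S.X₃] (n : ℕ) :
    realLength A (torOne A S.X₂ n) ≤
      realLength A (torOne A S.X₁ n) + realLength A (torOne A S.X₃ n) := by
  have hi := hS.moduleCat_injective_f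
  have hp := hS.moduleCat_surjective_g
  have hexact := (ShortComplex.ShortExact.moduleCat_exact_iff_function_exact S).1 hS.exact
  obtain ⟨F, _, _, π, hπ⟩ := exists_finite_projective_presentation S.X₁
  obtain ⟨G, _, _, ρ, hρ⟩ := exists_finite_projective_presentation S.X₃
  obtain ⟨τ, f, g, hτ, hg, hfg⟩ := exists_horseshoe hi hp hexact hπ hρ
  rw [realLength_torOne hτ, realLength_torOne hπ, realLength_torOne hρ, hilbertSamuel_prod]
  linarith [hilbertSamuel_le_add hg hfg (n + 1), hilbertSamuel_le_add hp hexact (n + 1)]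

lemma realLength_torOne_biprod (M N : ModuleCat.{u} A) [Module.Finite A M] [Module.Finite A N]
    (n : ℕ) :
    realLength A (torOne A (M ⊞ N) n) =
      realLength A (torOne A M n) + realLength A (torOne A N n) := by
  obtain ⟨F, _, _, π, hπ⟩ := exists_finite_projective_presentation M
  obtain ⟨G, _, _, ρ, hρ⟩ := exists_finite_projective_presentation N
  have hiso : realLength A (torOne A (M ⊞ N) n) = realLength A (torOne A (.of A (M × N)) n) :=
    realLength_congr ((((Tor' _ 1).mapIso (ModuleCat.biprodIsoProd M N)).app _).toLinearEquiv)
  have hprod : Function.Surjective (π.prodMap ρ) := hπ.prodMap hρ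
  rw [hiso, realLength_torOne (M := .of A (M × N)) hprod, realLength_torOne hπ,
    realLength_torOne hρ, hilbertSamuel_congr (kerProdMapEquiv π ρ), hilbertSamuel_prod,
    hilbertSamuel_prod, hilbertSamuel_prod]
  ring

theorem eT_le_add {S : ShortComplex (ModuleCat.{u} A)} (hS : S.ShortExact)
    [Module.Finite A S.X₁] [Module.Finite A S.X₂] [Module.Finite A S.X₃] :
    eT A S.X₂ ≤ eT A S.X₁ + eT A S.X₃ := by
  refine le_of_tendsto_of_tendsto' (tendsto_eTSeq S.X₂)
    ((tendsto_eTSeq S.X₁).add (tendsto_eTSeq S.X₃)) fun n => ?_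
  simp only [eTSeq_eq_mul_realLength, ← mul_add]
  exact mul_le_mul_of_nonneg_left (realLength_torOne_le_add hS n) (by positivity)

theorem eT_biprod (M N : ModuleCat.{u} A) [Module.Finite A M] [Module.Finite A N] :
    eT A (M ⊞ N) = eT A M + eT A N := by
  have : Module.Finite A (M ⊞ N : ModuleCat.{u} A) :=
    Module.Finite.equiv (ModuleCat.biprodIsoProd M N).symm.toLinearEquiv
  refine tendsto_nhds_unique (tendsto_eTSeq (M ⊞ N))
    (((tendsto_eTSeq M).add (tendsto_eTSeq N)).congr fun n => ?_)
  simp only [eTSeq_eq_mul_realLength, ← mul_add, realLength_torOne_biprod]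

end TorOne

section Abelian

variable {C : Type*} [Category* C] [Abelian C]

lemma shortExact_of_isPullback {S : ShortComplex C} (hS : S.ShortExact) {X Y : C} {t : X ⟶ S.X₂}
    {l : X ⟶ Y} {b : Y ⟶ S.X₃} (h : IsPullback t l S.g b) :
    (ShortComplex.mk (h.lift S.f 0 (by simp)) l (by simp)).ShortExact := by
  have := hS.mono_f
  have := hS.epi_g
  have hf : Mono (h.lift S.f 0 (by simp)) := mono_of_mono_fac (h.lift_fst _ _ _)
  have hl : Epi l := MorphismProperty.of_isPullback (P := .epimorphisms C) h hS.epi_g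
  refine { exact := ShortComplex.exact_of_f_is_kernel _ (Fork.IsLimit.mk' _ fun s => ?_) }
  have hs : s.ι ≫ l = 0 := by simp
  have hst : (s.ι ≫ t) ≫ S.g = 0 := by simp [h.w, reassoc_of% hs]
  refine ⟨hS.exact.lift (s.ι ≫ t) hst, h.hom_ext (by simp) (by simp), fun hm => ?_⟩
  exact (cancel_mono (h.lift S.f 0 _)).1 (hm.trans (h.hom_ext (by simp) (by simp)))

lemma shortExact_of_isPushout {S : ShortComplex C} (hS : S.ShortExact) {X Y : C} {t : S.X₁ ⟶ Y}
    {r : S.X₂ ⟶ X} {b : Y ⟶ X} (h : IsPushout S.f t r b) :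
    (ShortComplex.mk b (h.desc S.g 0 (by simp)) (by simp)).ShortExact := by
  have := hS.mono_f
  have := hS.epi_g
  have hg : Epi (h.desc S.g 0 (by simp)) := epi_of_epi_fac (h.inl_desc _ _ _)
  have hb : Mono b := MorphismProperty.of_isPushout (P := .monomorphisms C) h.flip hS.mono_f
  refine { exact := ShortComplex.exact_of_g_is_cokernel _ (Cofork.IsColimit.mk' _ fun s => ?_) }
  have hs : b ≫ s.π = 0 := by simp
  have hst : S.f ≫ r ≫ s.π = 0 := by simp [h.w_assoc, hs]
  refine ⟨hS.exact.desc (r ≫ s.π) hst, h.hom_ext (by simp) (by simp), fun hm => ?_⟩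
  exact (cancel_epi (h.desc S.g 0 _)).1 (hm.trans (h.hom_ext (by simp) (by simp)))

lemma isPullback_of_isIso_τ₁ {S S' : ShortComplex C} (hS : S.ShortExact) (hS' : S'.ShortExact)
    (φ : S ⟶ S') [IsIso φ.τ₁] : IsPullback φ.τ₂ S.g S'.g φ.τ₃ := by
  have hP := IsPullback.of_hasPullback S'.g φ.τ₃
  have hι := shortExact_of_isPullback hS' hP
  let ψ : S ⟶ ShortComplex.mk (hP.lift S'.f 0 (by simp)) (pullback.snd S'.g φ.τ₃) (by simp) :=
    { τ₁ := φ.τ₁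
      τ₂ := hP.lift φ.τ₂ S.g φ.comm₂₃
      τ₃ := 𝟙 _
      comm₁₂ := hP.hom_ext (by simp [φ.comm₁₂]) (by simp)
      comm₂₃ := by simp }
  have : IsIso ψ.τ₂ := ShortComplex.isIso₂_of_shortExact_of_isIso₁₃' ψ hS hι ‹_› inferInstance
  exact IsPullback.of_iso_pullback ⟨φ.comm₂₃⟩ (asIso ψ.τ₂) (hP.lift_fst _ _ _) (hP.lift_snd _ _ _)

lemma shortExact_shortComplex' {X₁ X₂ X₃ X₄ : C} {t : X₁ ⟶ X₂} {l : X₁ ⟶ X₃} {r : X₂ ⟶ X₄}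
    {b : X₃ ⟶ X₄} [Epi r] (h : IsPullback t l r b) : h.shortComplex'.ShortExact where
  exact := h.exact_shortComplex'
  mono_f := h.mono_shortComplex'_f
  epi_g :=
    have : Epi (biprod.inl ≫ biprod.desc r (-b)) := by rwa [biprod.inl_desc]
    epi_of_epi biprod.inl (biprod.desc r (-b))

lemma shortExact_shortComplex {X₁ X₂ X₃ X₄ : C} {t : X₁ ⟶ X₂} {l : X₁ ⟶ X₃} {r : X₂ ⟶ X₄}
    {b : X₃ ⟶ X₄} [Mono t] (h : IsPushout t l r b) : h.shortComplex.ShortExact where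
  exact := h.exact_shortComplex
  mono_f :=
    have : Mono (biprod.lift t (-l) ≫ biprod.fst) := by rwa [biprod.lift_fst]
    mono_of_mono (biprod.lift t (-l)) biprod.fst
  epi_g := h.epi_shortComplex_g

section ExtClass

universe w

variable [HasExt.{w} C]

lemma extClass_of_isPullback {S : ShortComplex C} (hS : S.ShortExact) {X Y : C} {t : X ⟶ S.X₂}
    {l : X ⟶ Y} {b : Y ⟶ S.X₃} (h : IsPullback t l S.g b) :
    (shortExact_of_isPullback hS h).extClass =
      (Ext.mk₀ b).comp hS.extClass (zero_add 1) := by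
  have := ShortComplex.ShortExact.extClass_naturality (shortExact_of_isPullback hS h) hS
    { τ₁ := 𝟙 _, τ₂ := t, τ₃ := b, comm₁₂ := by simp, comm₂₃ := h.w }
  rwa [Ext.comp_mk₀_id] at this

lemma extClass_of_isPushout {S : ShortComplex C} (hS : S.ShortExact) {X Y : C} {t : S.X₁ ⟶ Y}
    {r : S.X₂ ⟶ X} {b : Y ⟶ X} (h : IsPushout S.f t r b) :
    (shortExact_of_isPushout hS h).extClass = hS.extClass.comp (Ext.mk₀ t) (add_zero 1) := by
  have := ShortComplex.ShortExact.extClass_naturality hS (shortExact_of_isPushout hS h)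
    { τ₁ := t, τ₂ := r, τ₃ := 𝟙 _, comm₁₂ := h.w.symm, comm₂₃ := by simp }
  rw [Ext.mk₀_id_comp] at this
  exact this.symm

lemma exists_hom_of_extClass_eq {X Y E E' : C} {i : Y ⟶ E} {p : E ⟶ X} {w : i ≫ p = 0}
    (hS : (ShortComplex.mk i p w).ShortExact) {i' : Y ⟶ E'} {p' : E' ⟶ X} {w' : i' ≫ p' = 0}
    (hS' : (ShortComplex.mk i' p' w').ShortExact) (h : hS.extClass = hS'.extClass) :
    ∃ φ : E ⟶ E', i ≫ φ = i' := by
  obtain ⟨x, hx⟩ := Ext.contravariant_sequence_exact₁ hS _ (Ext.mk₀ i') (add_zero 1)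
    (h ▸ hS'.extClass_comp)
  obtain ⟨φ, rfl⟩ := (Ext.mk₀_bijective _ _).2 x
  rw [Ext.mk₀_comp_mk₀] at hx
  exact ⟨φ, (Ext.mk₀_bijective _ _).1 hx⟩

lemma exists_extClass_eq [EnoughProjectives C] {X Y : C} (α : Ext X Y 1) :
    ∃ (E : C) (i : Y ⟶ E) (p : E ⟶ X) (w : i ≫ p = 0)
      (hS : (ShortComplex.mk i p w).ShortExact), hS.extClass = α := by
  have hK : (ShortComplex.mk _ _ (kernel.condition (Projective.π X))).ShortExact :=
    { exact := ShortComplex.exact_kernel _ }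
  obtain ⟨x, hx⟩ := Ext.contravariant_sequence_exact₃ hK _ α (Ext.eq_zero_of_projective _)
    (add_zero 1)
  obtain ⟨f, rfl⟩ := (Ext.mk₀_bijective _ _).2 x
  have h := IsPushout.of_hasPushout (kernel.ι (Projective.π X)) f
  exact ⟨_, _, _, _, shortExact_of_isPushout hK h, (extClass_of_isPushout hK h).trans hx⟩

end ExtClass

end Abelian

section Subadditive

universe w

variable {C : Type*} [Category* C] [Abelian C] {P : ObjectProperty C} {e : C → ℝ}

/-- A real function `e` on objects which, on `P`, is additive on direct sums and subadditive on
short exact sequences. This is all that is used of `e^T` to see that `T_A` is a subfunctor. -/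
structure IsSubadditiveOn (P : ObjectProperty C) (e : C → ℝ) : Prop where
  biprod {X Y : C} (hX : P X) (hY : P Y) : e (X ⊞ Y) = e X + e Y
  le_add {S : ShortComplex C} (hS : S.ShortExact) (h₁ : P S.X₁) (h₃ : P S.X₃) :
    e S.X₂ ≤ e S.X₁ + e S.X₃

namespace IsSubadditiveOn

lemma add_le_of_isPullback (he : IsSubadditiveOn P e) {X₁ X₂ X₃ X₄ : C} {t : X₁ ⟶ X₂}
    {l : X₁ ⟶ X₃} {r : X₂ ⟶ X₄} {b : X₃ ⟶ X₄} [Epi r] (h : IsPullback t l r b) (h₁ : P X₁)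
    (h₂ : P X₂) (h₃ : P X₃) (h₄ : P X₄) : e X₂ + e X₃ ≤ e X₁ + e X₄ :=
  he.biprod h₂ h₃ ▸ he.le_add (shortExact_shortComplex' h) h₁ h₄

lemma add_le_of_isPushout (he : IsSubadditiveOn P e) {X₁ X₂ X₃ X₄ : C} {t : X₁ ⟶ X₂}
    {l : X₁ ⟶ X₃} {r : X₂ ⟶ X₄} {b : X₃ ⟶ X₄} [Mono t] (h : IsPushout t l r b) (h₁ : P X₁)
    (h₂ : P X₂) (h₃ : P X₃) (h₄ : P X₄) : e X₂ + e X₃ ≤ e X₁ + e X₄ :=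
  he.biprod h₂ h₃ ▸ he.le_add (shortExact_shortComplex h) h₁ h₄

end IsSubadditiveOn

variable [HasExt.{w} C]

/-- The classes in `Ext¹(X, Y)` of the extensions `0 ⟶ Y ⟶ E ⟶ X ⟶ 0` along which `e` is additive.
For `e = e^T` this is `T_A(X, Y)`. -/
def additiveExt (e : C → ℝ) (X Y : C) : Set (Ext.{w} X Y 1) :=
  {α | ∃ (E : C) (i : Y ⟶ E) (p : E ⟶ X) (w : i ≫ p = 0)
    (hS : (ShortComplex.mk i p w).ShortExact), hS.extClass = α ∧ e X + e Y = e E}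

lemma mem_additiveExt_of_le (he : IsSubadditiveOn P e) {S : ShortComplex C} (hS : S.ShortExact)
    (h₁ : P S.X₁) (h₃ : P S.X₃) (h : e S.X₃ + e S.X₁ ≤ e S.X₂) :
    hS.extClass ∈ additiveExt e S.X₃ S.X₁ :=
  ⟨_, _, _, _, hS, rfl, h.antisymm (add_comm (e S.X₁) _ ▸ he.le_add hS h₁ h₃)⟩

lemma zero_mem_additiveExt (he : IsSubadditiveOn P e) {X Y : C} (hX : P X) (hY : P Y) :
    (0 : Ext.{w} X Y 1) ∈ additiveExt e X Y := by
  have hS := (ShortComplex.Splitting.ofHasBinaryBiproduct Y X).shortExact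
  refine ⟨_, _, _, _, hS, ?_, by rw [he.biprod hY hX, add_comm]⟩
  have h := congrArg (fun x => (Ext.mk₀ (biprod.inr : X ⟶ Y ⊞ X)).comp x (zero_add 1))
    hS.comp_extClass
  simpa using h

variable [P.IsClosedUnderExtensions]

lemma le_of_extClass_eq (he : IsSubadditiveOn P e) {X Y E E' : C} {i : Y ⟶ E} {p : E ⟶ X}
    {w : i ≫ p = 0} (hS : (ShortComplex.mk i p w).ShortExact) {i' : Y ⟶ E'} {p' : E' ⟶ X}
    {w' : i' ≫ p' = 0} (hS' : (ShortComplex.mk i' p' w').ShortExact)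
    (h : hS.extClass = hS'.extClass) (hX : P X) (hY : P Y) : e E' ≤ e E := by
  obtain ⟨φ, hφ⟩ := exists_hom_of_extClass_eq hS hS' h
  have : Epi p := hS.epi_g
  have : Epi p' := hS'.epi_g
  let Φ : ShortComplex.mk i p w ⟶ ShortComplex.mk i' p' w' :=
    { τ₁ := 𝟙 Y
      τ₂ := φ
      τ₃ := hS.exact.desc (φ ≫ p') (by simp [reassoc_of% hφ, w'])
      comm₁₂ := by simp [hφ]
      comm₂₃ := (hS.exact.g_desc _ _).symm }
  have := he.add_le_of_isPullback (isPullback_of_isIso_τ₁ hS hS' Φ)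
    (P.prop_X₂_of_shortExact hS hY hX) (P.prop_X₂_of_shortExact hS' hY hX) hX hX
  exact le_of_add_le_add_right this

lemma extClass_mem_additiveExt_iff (he : IsSubadditiveOn P e) {S : ShortComplex C}
    (hS : S.ShortExact) (h₁ : P S.X₁) (h₃ : P S.X₃) :
    hS.extClass ∈ additiveExt e S.X₃ S.X₁ ↔ e S.X₃ + e S.X₁ = e S.X₂ := by
  refine ⟨?_, fun h => mem_additiveExt_of_le he hS h₁ h₃ h.le⟩
  rintro ⟨E, i, p, w, hE, hα, h⟩
  exact h.trans ((le_of_extClass_eq he hS hE hα.symm h₃ h₁).antisymm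
    (le_of_extClass_eq he hE hS hα h₃ h₁))

lemma mk₀_comp_mem_additiveExt (he : IsSubadditiveOn P e) {X X' Y : C} (hX : P X) (hX' : P X')
    (hY : P Y) {α : Ext X Y 1} (hα : α ∈ additiveExt e X Y) (g : X' ⟶ X) :
    (Ext.mk₀ g).comp α (zero_add 1) ∈ additiveExt e X' Y := by
  obtain ⟨E, i, p, w, hS, rfl, h⟩ := hα
  have : Epi p := hS.epi_g
  have hsq := IsPullback.of_hasPullback p g
  have hS' := shortExact_of_isPullback hS hsq
  have := he.add_le_of_isPullback hsq (P.prop_X₂_of_shortExact hS' hY hX')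
    (P.prop_X₂_of_shortExact hS hY hX) hX' hX
  rw [← extClass_of_isPullback hS hsq]
  exact mem_additiveExt_of_le he hS' hY hX' (by dsimp only; linarith)

lemma comp_mk₀_mem_additiveExt (he : IsSubadditiveOn P e) {X Y Y' : C} (hX : P X) (hY : P Y)
    (hY' : P Y') {α : Ext X Y 1} (hα : α ∈ additiveExt e X Y) (f : Y ⟶ Y') :
    α.comp (Ext.mk₀ f) (add_zero 1) ∈ additiveExt e X Y' := by
  obtain ⟨E, i, p, w, hS, rfl, h⟩ := hα
  have : Mono i := hS.mono_f
  have hsq := IsPushout.of_hasPushout i f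
  have hS' := shortExact_of_isPushout hS hsq
  have := he.add_le_of_isPushout hsq hY (P.prop_X₂_of_shortExact hS hY hX) hY'
    (P.prop_X₂_of_shortExact hS' hY' hX)
  rw [← extClass_of_isPushout hS hsq]
  exact mem_additiveExt_of_le he hS' hY' hX (by dsimp only; linarith)

lemma add_mem_additiveExt [EnoughProjectives C] (he : IsSubadditiveOn P e) {X Y : C} (hX : P X)
    (hY : P Y) {α β : Ext X Y 1} (hα : α ∈ additiveExt e X Y) (hβ : β ∈ additiveExt e X Y) :
    α + β ∈ additiveExt e X Y := by
  obtain ⟨E, i, p, w, hS, rfl, hE⟩ := hα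
  obtain ⟨F, j, q, w', hT, hα⟩ := exists_extClass_eq (hS.extClass + β)
  have : Epi p := hS.epi_g
  have hPE := P.prop_X₂_of_shortExact hS hY hX
  have hPF := P.prop_X₂_of_shortExact hT hY hX
  have hsq := (IsPullback.of_hasPullback q p).flip
  have hQ := shortExact_of_isPullback hT hsq.flip
  have hQα : hQ.extClass ∈ additiveExt e E Y := by
    rw [extClass_of_isPullback hT hsq.flip, hα, Ext.comp_add, hS.comp_extClass, zero_add]
    exact mk₀_comp_mem_additiveExt he hX hPE hY hβ p
  have h₁ := (extClass_mem_additiveExt_iff he hQ hY hPE).1 hQα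
  have h₂ := he.le_add (shortExact_of_isPullback hS hsq) hY hPF
  rw [← hα]
  exact mem_additiveExt_of_le he hT hY hX (by dsimp only at h₁ h₂ ⊢; linarith)

/-- `additiveExt` as a submodule of `Ext¹(X, Y)`, for the Baer sum of extensions. -/
def additiveExtSubmodule (R : Type*) [CommRing R] [Linear R C] [EnoughProjectives C]
    (he : IsSubadditiveOn P e) {X Y : C} (hX : P X) (hY : P Y) :
    Submodule R (Ext.{w} X Y 1) where
  carrier := additiveExt e X Y
  zero_mem' := zero_mem_additiveExt he hX hY
  add_mem' := add_mem_additiveExt he hX hY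
  smul_mem' r α hα := by
    have := comp_mk₀_mem_additiveExt he hX hY hY hα (r • 𝟙 Y)
    rwa [Ext.mk₀_smul, Ext.comp_smul, Ext.comp_mk₀_id] at this

end Subadditive

section Subfunctor

variable {A : Type*} [CommRing A] [IsNoetherianRing A] {C D : Type*} [Category* C] [Category* D]

/-- The subfunctor of a functor `F` to finitely generated modules given by submodules of its
values which are stable under the maps of `F`. -/
def subfunctor (F : D ⥤ FGModuleCat A) (Q : ∀ Y, Submodule A (F.obj Y))
    (hQ : ∀ {Y Y' : D} (g : Y ⟶ Y'), Q Y ≤ (Q Y').comap (F.map g).hom.hom) :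
    D ⥤ FGModuleCat A where
  obj Y := FGModuleCat.of A (Q Y)
  map g := FGModuleCat.ofHom ((F.map g).hom.hom.restrict (hQ g))
  map_id Y := FGModuleCat.hom_ext (LinearMap.ext fun α => Subtype.ext
    (congrArg (fun h => h.hom.hom α.1) (F.map_id Y)))
  map_comp f g := FGModuleCat.hom_ext (LinearMap.ext fun α => Subtype.ext
    (congrArg (fun h => h.hom.hom α.1) (F.map_comp f g)))

/-- A natural transformation that respects the given submodules, restricted to the subfunctors
they define. -/
def subfunctorMap {F F' : D ⥤ FGModuleCat A} (φ : F ⟶ F') {Q : ∀ Y, Submodule A (F.obj Y)}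
    {Q' : ∀ Y, Submodule A (F'.obj Y)}
    {hQ : ∀ {Y Y' : D} (g : Y ⟶ Y'), Q Y ≤ (Q Y').comap (F.map g).hom.hom}
    {hQ' : ∀ {Y Y' : D} (g : Y ⟶ Y'), Q' Y ≤ (Q' Y').comap (F'.map g).hom.hom}
    (hφ : ∀ Y, Q Y ≤ (Q' Y).comap (φ.app Y).hom.hom) :
    subfunctor F Q hQ ⟶ subfunctor F' Q' hQ' where
  app Y := FGModuleCat.ofHom ((φ.app Y).hom.hom.restrict (hφ Y))
  naturality _ _ g := FGModuleCat.hom_ext (LinearMap.ext fun α => Subtype.ext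
    (congrArg (fun h => h.hom.hom α.1) (φ.naturality g)))

/-- The subfunctor of a bifunctor `F` to finitely generated modules given by submodules of its
values which are stable under the maps of `F` in both variables. -/
def subbifunctor (F : C ⥤ D ⥤ FGModuleCat A) (Q : ∀ X Y, Submodule A ((F.obj X).obj Y))
    (hC : ∀ {X X' : C} (f : X ⟶ X') (Y : D), Q X Y ≤ (Q X' Y).comap ((F.map f).app Y).hom.hom)
    (hD : ∀ (X : C) {Y Y' : D} (g : Y ⟶ Y'),
      Q X Y ≤ (Q X Y').comap ((F.obj X).map g).hom.hom) :
    C ⥤ D ⥤ FGModuleCat A where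
  obj X := subfunctor (F.obj X) (Q X) (hD X)
  map f := subfunctorMap (F.map f) (hC f)
  map_id X := NatTrans.ext <| funext fun Y => FGModuleCat.hom_ext <| LinearMap.ext fun α =>
    Subtype.ext (congrArg (fun h => (h.app Y).hom.hom α.1) (F.map_id X))
  map_comp f g := NatTrans.ext <| funext fun Y => FGModuleCat.hom_ext <| LinearMap.ext fun α =>
    Subtype.ext (congrArg (fun h => (h.app Y).hom.hom α.1) (F.map_comp f g))

/-- The inclusion of a subfunctor of a bifunctor. -/
def subbifunctorι (F : C ⥤ D ⥤ FGModuleCat A) (Q : ∀ X Y, Submodule A ((F.obj X).obj Y))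
    (hC : ∀ {X X' : C} (f : X ⟶ X') (Y : D), Q X Y ≤ (Q X' Y).comap ((F.map f).app Y).hom.hom)
    (hD : ∀ (X : C) {Y Y' : D} (g : Y ⟶ Y'),
      Q X Y ≤ (Q X Y').comap ((F.obj X).map g).hom.hom) :
    subbifunctor F Q hC hD ⟶ F where
  app X := { app Y := FGModuleCat.ofHom (Q X Y).subtype }

section

variable {F : C ⥤ D ⥤ FGModuleCat A} {Q : ∀ X Y, Submodule A ((F.obj X).obj Y)}
  (hC : ∀ {X X' : C} (f : X ⟶ X') (Y : D), Q X Y ≤ (Q X' Y).comap ((F.map f).app Y).hom.hom)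
  (hD : ∀ (X : C) {Y Y' : D} (g : Y ⟶ Y'), Q X Y ≤ (Q X Y').comap ((F.obj X).map g).hom.hom)
  (X : C) (Y : D)

lemma subbifunctorι_injective :
    Function.Injective (((subbifunctorι F Q hC hD).app X).app Y).hom.hom :=
  (Q X Y).subtype_injective

lemma range_subbifunctorι :
    Set.range (((subbifunctorι F Q hC hD).app X).app Y).hom.hom = Q X Y :=
  Subtype.range_coe

end

end Subfunctor

instance (A : Type u) [CommRing A] : (ModuleCat.isFG.{u} A).IsClosedUnderExtensions where
  prop_X₂_of_shortExact {S} hS h₁ h₃ :=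
    have : Module.Finite A S.X₁ := h₁
    have : Module.Finite A S.X₃ := h₃
    Module.Finite.of_exact
      ((ShortComplex.ShortExact.moduleCat_exact_iff_function_exact S).1 hS.exact)
      hS.moduleCat_surjective_g

section Depth

variable {A : Type u} [CommRing A] [IsLocalRing A]

lemma mcmProperty_le_isFG : mcmProperty A ≤ ModuleCat.isFG A := fun _ hM => hM.1

lemma maximalIdeal_smul_top_lt (M : Type*) [AddCommGroup M] [Module A M] [Module.Finite A M]
    [Nontrivial M] : maximalIdeal A • (⊤ : Submodule A M) < ⊤ :=
  (Submodule.top_ne_ideal_smul_of_le_jacobson_annihilator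
    (IsLocalRing.maximalIdeal_le_jacobson _)).symm.lt_top

variable [IsNoetherianRing A]

lemma isMCM_iff_subsingleton_ext (M : ModuleCat.{u} A) [Module.Finite A M] :
    IsMCM A M ↔
      ∀ i < dim A, Subsingleton (Ext.{u} (ModuleCat.of A (A ⧸ maximalIdeal A)) M i) := by
  rcases subsingleton_or_nontrivial M with hM | hM
  · have hM₀ := ModuleCat.isZero_of_subsingleton M
    refine ⟨fun _ i _ => subsingleton_of_forall_eq 0 fun x => ?_,
      fun _ => ⟨inferInstance, Or.inl hM⟩⟩
    rw [← x.comp_mk₀_id, hM₀.eq_of_src (𝟙 M) 0, Ext.mk₀_zero, Ext.comp_zero]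
  have hlt := maximalIdeal_smul_top_lt (A := A) M
  have hsupp : Module.support A (A ⧸ maximalIdeal A) =
      PrimeSpectrum.zeroLocus (maximalIdeal A) := by
    rw [Module.support_eq_zeroLocus, Ideal.annihilator_quotient]
  constructor
  · rintro ⟨-, h⟩
    obtain ⟨rs, hrs, hlength, hreg⟩ := h.resolve_left (not_subsingleton M)
    have hd : rs.length = dim A := by
      rw [← coe_dim] at hlength
      exact_mod_cast hlength
    exact hd ▸ ModuleCat.subsingleton_ext_of_exists_isRegular (maximalIdeal A) _
      hsupp.subset M hlt rs hrs hreg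
  · intro h
    obtain ⟨rs, hlength, hrs, hreg⟩ := ModuleCat.exists_isRegular_of_exists_subsingleton_ext
      (maximalIdeal A) (dim A) M hlt _ hsupp h
    exact ⟨inferInstance, Or.inr ⟨rs, hrs, by rw [hlength, coe_dim], hreg⟩⟩

instance : (mcmProperty A).IsClosedUnderExtensions where
  prop_X₂_of_shortExact {S} hS h₁ h₃ := by
    have : Module.Finite A S.X₁ := h₁.1
    have : Module.Finite A S.X₃ := h₃.1
    have : Module.Finite A S.X₂ :=
      (ModuleCat.isFG A).prop_X₂_of_shortExact hS h₁.1 h₃.1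
    refine (isMCM_iff_subsingleton_ext S.X₂).2 fun i hi => ?_
    have := (isMCM_iff_subsingleton_ext S.X₁).1 h₁ i hi
    have := (isMCM_iff_subsingleton_ext S.X₃).1 h₃ i hi
    refine subsingleton_of_forall_eq 0 fun x => ?_
    obtain ⟨y, rfl⟩ := Ext.covariant_sequence_exact₂ _ hS x (Subsingleton.elim _ _)
    rw [Subsingleton.elim y 0, Ext.zero_comp]

end Depth

section Main

variable {A : Type u} [CommRing A] [IsLocalRing A]

lemma tSplit_eq_additiveExt (M N : ModuleCat.{u} A) : tSplit A M N = additiveExt (eT A) M N := by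
  simp only [tSplit, additiveExt, eTDefect, sub_eq_zero]

variable [IsNoetherianRing A]

lemma isSubadditiveOn_eT : IsSubadditiveOn (ModuleCat.isFG A) (eT A) where
  biprod {M N} hM hN :=
    have : Module.Finite A M := hM
    have : Module.Finite A N := hN
    eT_biprod M N
  le_add {S} hS h₁ h₃ :=
    have : Module.Finite A S.X₁ := h₁
    have : Module.Finite A S.X₃ := h₃
    have : Module.Finite A S.X₂ := (ModuleCat.isFG A).prop_X₂_of_shortExact hS h₁ h₃
    eT_le_add hS

lemma extClass_mem_tSplit_iff {S : ShortComplex (ModuleCat.{u} A)} (hS : S.ShortExact)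
    [Module.Finite A S.X₁] [Module.Finite A S.X₃] :
    hS.extClass ∈ tSplit A S.X₃ S.X₁ ↔ eTDefect A S = 0 := by
  rw [tSplit_eq_additiveExt, eTDefect, sub_eq_zero]
  exact extClass_mem_additiveExt_iff isSubadditiveOn_eT hS ‹Module.Finite A S.X₁› ‹_›

variable {P : ObjectProperty (ModuleCat.{u} A)} (hP : P ≤ ModuleCat.isFG A)

/-- The bifunctor `Ext¹` on a full subcategory of the finitely generated modules; `extOne A` is
the case of the maximal Cohen–Macaulay modules. -/
def extOneOn : P.FullSubcategoryᵒᵖ ⥤ P.FullSubcategory ⥤ FGModuleCat.{u} A where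
  obj M :=
    { obj N := ⟨ModuleCat.of A (Ext.{u} M.unop.obj N.obj 1), by
        have : Module.Finite A M.unop.obj := hP _ M.unop.property
        have : Module.Finite A N.obj := hP _ N.property
        exact inferInstanceAs (Module.Finite A (Ext.{u} M.unop.obj N.obj 1))⟩
      map f := ObjectProperty.homMk
        (ModuleCat.ofHom ((Ext.mk₀ f.hom).postcompOfLinear A M.unop.obj (add_zero 1)))
      map_id N := by
        apply FGModuleCat.hom_ext
        ext α
        simp
      map_comp f g := by
        apply FGModuleCat.hom_ext
        ext α
        simp [← Ext.mk₀_comp_mk₀, Ext.comp_assoc_of_second_deg_zero] }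
  map g :=
    { app N := ObjectProperty.homMk
        (ModuleCat.ofHom ((Ext.mk₀ g.unop.hom).precompOfLinear A N.obj (zero_add 1)))
      naturality N N' f := by
        apply FGModuleCat.hom_ext
        ext α
        simp [Ext.comp_assoc_of_third_deg_zero] }
  map_id M := by
    ext N
    simp
  map_comp g h := by
    ext N
    simp

/-- `T_A(M, N)` as a submodule of `Ext¹(M, N)`. -/
def tSplitSubmodule (M N : P.FullSubcategory) : Submodule A (Ext.{u} M.obj N.obj 1) :=
  additiveExtSubmodule A isSubadditiveOn_eT (hP _ M.property) (hP _ N.property)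

lemma coe_tSplitSubmodule (M N : P.FullSubcategory) :
    (tSplitSubmodule hP M N : Set (Ext.{u} M.obj N.obj 1)) = tSplit A M.obj N.obj :=
  (tSplit_eq_additiveExt _ _).symm

lemma tSplitSubmodule_le_comap_precomp {M M' : P.FullSubcategoryᵒᵖ} (g : M ⟶ M')
    (N : P.FullSubcategory) :
    tSplitSubmodule hP M.unop N ≤
      (tSplitSubmodule hP M'.unop N).comap (((extOneOn hP).map g).app N).hom.hom :=
  fun _ hα => mk₀_comp_mem_additiveExt isSubadditiveOn_eT (hP _ M.unop.property)
    (hP _ M'.unop.property) (hP _ N.property) hα g.unop.hom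

lemma tSplitSubmodule_le_comap_postcomp (M : P.FullSubcategoryᵒᵖ) {N N' : P.FullSubcategory}
    (f : N ⟶ N') :
    tSplitSubmodule hP M.unop N ≤
      (tSplitSubmodule hP M.unop N').comap (((extOneOn hP).obj M).map f).hom.hom :=
  fun _ hα => comp_mk₀_mem_additiveExt isSubadditiveOn_eT (hP _ M.unop.property)
    (hP _ N.property) (hP _ N'.property) hα f.hom

/-- `T_A` as a bifunctor on a full subcategory of the finitely generated modules. -/
def tSplitFunctor : P.FullSubcategoryᵒᵖ ⥤ P.FullSubcategory ⥤ FGModuleCat.{u} A :=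
  subbifunctor (extOneOn hP) (fun M N => tSplitSubmodule hP M.unop N)
    (tSplitSubmodule_le_comap_precomp hP) (tSplitSubmodule_le_comap_postcomp hP)

/-- The inclusion of `T_A` into `Ext¹`. -/
def tSplitInclusion : tSplitFunctor hP ⟶ extOneOn hP :=
  subbifunctorι _ _ (tSplitSubmodule_le_comap_precomp hP) (tSplitSubmodule_le_comap_postcomp hP)

lemma tSplitInclusion_injective (M : P.FullSubcategoryᵒᵖ) (N : P.FullSubcategory) :
    Function.Injective (((tSplitInclusion hP).app M).app N).hom.hom :=
  subbifunctorι_injective _ _ M N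

lemma range_tSplitInclusion (M : P.FullSubcategoryᵒᵖ) (N : P.FullSubcategory) :
    Set.range (((tSplitInclusion hP).app M).app N).hom.hom = tSplit A M.unop.obj N.obj :=
  (range_subbifunctorι _ _ M N).trans (coe_tSplitSubmodule hP M.unop N)

end Main

end TorSplit

end

open TorSplit Filter in
theorem theorem3_general (A : Type u) [CommRing A] [IsLocalRing A] [IsNoetherianRing A]
    (P : ObjectProperty (ModuleCat.{u} A)) [P.IsClosedUnderExtensions]
    (hP : P ≤ ModuleCat.isFG A) :
    (∀ M : P.FullSubcategory, (∀ n, Module.length A (torOne A M.obj n) ≠ ⊤) ∧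
      Tendsto (eTSeq A M.obj) atTop (nhds (eT A M.obj))) ∧
    (∀ (S : ShortComplex (ModuleCat.{u} A)) (hS : S.ShortExact), P S.X₁ → P S.X₃ →
      P S.X₂ ∧ (hS.extClass ∈ tSplit A S.X₃ S.X₁ ↔ eTDefect A S = 0)) ∧
    (∀ M N : P.FullSubcategory, ∃ Q : Submodule A (Ext.{u} M.obj N.obj 1),
      (Q : Set (Ext.{u} M.obj N.obj 1)) = tSplit A M.obj N.obj) ∧
    (∃ (T : P.FullSubcategoryᵒᵖ ⥤ P.FullSubcategory ⥤ FGModuleCat.{u} A) (ι : T ⟶ extOneOn hP),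
      ∀ M N : P.FullSubcategory,
        Function.Injective ((ι.app (Opposite.op M)).app N).hom.hom ∧
        Set.range ((ι.app (Opposite.op M)).app N).hom.hom = tSplit A M.obj N.obj) := by
  refine ⟨fun M => ?_, fun S hS h₁ h₃ => ?_,
    fun M N => ⟨tSplitSubmodule hP M N, coe_tSplitSubmodule hP M N⟩,
    tSplitFunctor hP, tSplitInclusion hP, fun M N =>
      ⟨tSplitInclusion_injective hP (.op M) N, range_tSplitInclusion hP (.op M) N⟩⟩
  · have : Module.Finite A M.obj := hP _ M.property
    exact ⟨fun n => Module.length_ne_top_iff.2 (isFiniteLength_torOne M.obj n),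
      tendsto_eTSeq M.obj⟩
  · have : Module.Finite A S.X₁ := hP _ h₁
    have : Module.Finite A S.X₃ := hP _ h₃
    exact ⟨P.prop_X₂_of_shortExact hS h₁ h₃, extClass_mem_tSplit_iff hS⟩

open TorSplit in
theorem theorem3 (A : Type u) [CommRing A] [IsCohenMacaulayLocal A] :
    -- the lengths are finite and the limit `e^T(M)` exists
    (∀ M : CM A, (∀ n, Module.length A (torOne A M.obj n) ≠ ⊤) ∧
      Filter.Tendsto (eTSeq A M.obj) Filter.atTop (nhds (eT A M.obj))) ∧
    -- `T`-splitness depends only on the class of an extension, and extensions stay in `CM(A)`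
    (∀ (S : ShortComplex (ModuleCat.{u} A)) (hS : S.ShortExact),
      IsMCM A S.X₁ → IsMCM A S.X₃ →
        IsMCM A S.X₂ ∧ (hS.extClass ∈ tSplit A S.X₃ S.X₁ ↔ eTDefect A S = 0)) ∧
    -- `T_A(M, N)` is a submodule of `Ext¹(M, N)`
    (∀ M N : CM A, ∃ P : Submodule A (Ext.{u} M.obj N.obj 1),
      (P : Set (Ext.{u} M.obj N.obj 1)) = tSplit A M.obj N.obj) ∧
    -- `T_A` is a subfunctor of `Ext¹`
    (∃ (T : (CM A)ᵒᵖ ⥤ CM A ⥤ FGModuleCat.{u} A) (ι : T ⟶ extOne A),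
      ∀ M N : CM A,
        Function.Injective ((ι.app (Opposite.op M)).app N).hom.hom ∧
        Set.range ((ι.app (Opposite.op M)).app N).hom.hom = tSplit A M.obj N.obj) :=
  theorem3_general A (mcmProperty A) mcmProperty_le_isFG
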